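/- A \emph{strictly skew-symmetric linking form} is a finite abelian group $M$ with a bilinear map $b\colon M\otimes M\to\mathbb{Q}/\mathbb{Z}$ such that $b(x,y)=-b(y,x)$ and $b(x,x)=0$ for all $x,y\in M$; morphisms of linking forms are group homomorphisms preserving $b$, and direct sums carry the orthogonal sum form. For an integer $k\ge 2$ let $W_k$ be $\mathbb{Z}/k\oplus\mathbb{Z}/k$ with standard generators $\rho=(1,0)$, $\sigma=(0,1)$ and the form determined by $b(\rho,\sigma)=-b(\sigma,\rho)=\tfrac1k$, $b(\rho,\rho)=b(\sigma,\sigma)=0$, and let $W_k^g$ be its $g$-fold direct sum. The \emph{$k$-rank} of $M$ is $r_k(M)=\max\{g\in\mathbb{N} : \text{there is a morphism } W_k^g\to M\}$, and the \emph{stable $k$-rank} is $\bar r_k(M)=\max\{r_k(M\oplus W_k^g)-g : g\in\mathbb{N}\}$. Two subgroups $N_1,N_2\le M$ are \emph{orthogonal} if $b(N_1,N_2)=b(N_2,N_1)=0$ and $N_1\cap N_2=0$. Let $L(M)_k$ be the simplicial complex whose vertices are the morphisms $f\colon W_k\to M$, a set of distinct vertices $\{f_0,\dots,f_p\}$ being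 a $p$-simplex if the images $f_i(W_k)$ are pairwise orthogonal. For a real number $c$, a space is \emph{$c$-connected} if it is nonempty when $c\ge -1$ and its homotopy groups $\pi_j$ (for $j=0$, its set of path components) are trivial at all base points for all integers $0\le j\le c$ (no condition if $c<-1$). For a simplicial complex $X$ and a simplex $\sigma$ of $X$, the link $\mathrm{lk}_X(\sigma)$ consists of the simplices $\zeta$ of $X$ disjoint from $\sigma$ such that $\sigma$ and $\zeta$ are both faces of some simplex of $X$; and $lCM(X)\ge n$ means that for every $p\ge 0$ the geometric realization of the link of every $p$-simplex of $X$ is $(n-p-2)$-connected. \textbf{Theorem.} Let $k\ge 2$ and $g\ge 0$ be integers and let $M$ be a strictly skew-symmetric linking form with $\bar r_k(M)\ge g$. Then the geometric realization $|L(M)_k|$ is $\tfrac12(g-4)$-connected, and $lCM(L(M)_k)\ge\tfrac12(g-1)$. -/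

import Mathlib

noncomputable section


universe u v

/-! ### Linking forms -/

namespace Linking

/-- The group `ℚ/ℤ`. -/
abbrev QModZ : Type := AddCircle (1 : ℚ)

/-- A bilinear pairing `M ⊗ M → ℚ/ℤ`. -/
abbrev Form (M : Type u) [AddCommGroup M] : Type u := M →+ M →+ QModZ

/-- Strict skew-symmetry: `b(x, y) = -b(y, x)` and `b(x, x) = 0`. -/
structure Form.IsStrictlySkew {M : Type u} [AddCommGroup M] (b : Form M) : Prop where
  skew : ∀ x y, b x y = -b y x
  self_eq_zero : ∀ x, b x x = 0

/-- Morphisms of linking forms: homomorphisms preserving the pairings. -/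
@[ext]
structure Hom {M : Type u} {N : Type v} [AddCommGroup M] [AddCommGroup N]
    (b : Form M) (c : Form N) where
  toFun : M →+ N
  map_form : ∀ x y, c (toFun x) (toFun y) = b x y

/-- The image of a morphism, as a subgroup of the target. -/
def Hom.range {M : Type u} {N : Type v} [AddCommGroup M] [AddCommGroup N]
    {b : Form M} {c : Form N} (f : Hom b c) : AddSubgroup N :=
  f.toFun.range

/-- The orthogonal complement of a subgroup. -/
def Form.orthogonal {M : Type u} [AddCommGroup M] (b : Form M) (N : AddSubgroup M) :
    AddSubgroup M where
  carrier := {x | ∀ y ∈ N, b x y = 0}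
  zero_mem' := by simp
  add_mem' := by
    intro x x' hx hx' y hy
    simp [hx y hy, hx' y hy]
  neg_mem' := by
    intro x hx y hy
    simp [hx y hy]

/-- Orthogonality of two subgroups (sub-linking forms). -/
def Form.AreOrthogonal {M : Type u} [AddCommGroup M] (b : Form M) (N₁ N₂ : AddSubgroup M) :
    Prop :=
  N₁ ≤ b.orthogonal N₂ ∧ N₂ ≤ b.orthogonal N₁ ∧ N₁ ⊓ N₂ = ⊥

/-- The orthogonal direct sum of two linking forms. -/
def Form.directSum {M : Type u} {N : Type v} [AddCommGroup M] [AddCommGroup N]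
    (b : Form M) (c : Form N) : Form (M × N) :=
  AddMonoidHom.mk'
    (fun x => (b x.1).comp (AddMonoidHom.fst M N) + (c x.2).comp (AddMonoidHom.snd M N))
    (by
      intro x y
      refine AddMonoidHom.ext fun z => ?_
      simp [add_add_add_comm])

/-- The `g`-fold orthogonal direct sum of a linking form. -/
def Form.power {M : Type u} [AddCommGroup M] (b : Form M) (g : ℕ) : Form (Fin g → M) :=
  AddMonoidHom.mk' (fun x => ∑ i, (b (x i)).comp (Pi.evalAddMonoidHom (fun _ => M) i)) (by
    intro x y
    ext z
    simp [Finset.sum_add_distrib, AddMonoidHom.finsetSum_apply])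

/-- The homomorphism `ℤ/k → ℚ/ℤ`, `n ↦ n/k`. -/
def divByK (k : ℕ) : ZMod k →+ QModZ :=
  ZMod.lift k ⟨zmultiplesHom QModZ (((1 / k : ℚ) : ℚ) : QModZ), by
    rcases Nat.eq_zero_or_pos k with rfl | hk
    · simp
    · have hk' : (k : ℚ) ≠ 0 := by exact_mod_cast hk.ne'
      rw [zmultiplesHom_apply, natCast_zsmul, ← AddCircle.coe_nsmul, nsmul_eq_mul,
        mul_one_div_cancel hk']
      exact AddCircle.coe_period 1⟩

/-- The underlying group `ℤ/k ⊕ ℤ/k` of the standard linking form. -/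
abbrev W (k : ℕ) : Type := ZMod k × ZMod k

/-- The standard form on `ℤ/k ⊕ ℤ/k`:
`b(ρ, σ) = 1/k = -b(σ, ρ)` and `b(ρ, ρ) = b(σ, σ) = 0` for `ρ = (1, 0)`, `σ = (0, 1)`. -/
def stdForm (k : ℕ) : Form (W k) :=
  AddMonoidHom.mk'
    (fun x => AddMonoidHom.mk' (fun y => divByK k (x.1 * y.2 - x.2 * y.1)) (by
      intro y z
      rw [← map_add]
      congr 1
      simp only [Prod.fst_add, Prod.snd_add]
      ring))
    (by
      intro x y
      refine AddMonoidHom.ext fun z => ?_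
      simp only [AddMonoidHom.mk'_apply, AddMonoidHom.add_apply, Prod.fst_add, Prod.snd_add]
      rw [← map_add]
      congr 1
      ring)

/-- The `k`-rank: the largest `g` for which there is a morphism `W_k^g → M`. For `k ≥ 2`
and finite `M` such morphisms are injective, so the set is bounded; it contains `0`. -/
def kRank (k : ℕ) {M : Type u} [AddCommGroup M] (b : Form M) : ℕ :=
  sSup {g : ℕ | Nonempty (Hom ((stdForm k).power g) b)}

/-- The stable `k`-rank: the maximum over `g` of `r_k(M ⊕ W_k^g) - g` (an integer). For `k ≥ 2`
and finite `M` these numbers are bounded above, by counting elements. -/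
def stableRank (k : ℕ) {M : Type u} [AddCommGroup M] (b : Form M) : ℤ :=
  sSup (Set.range fun g : ℕ => (kRank k (b.directSum ((stdForm k).power g)) : ℤ) - g)

/-- The complex `L(M)_k`: its vertices are the morphisms `W_k → M`, and a nonempty finite set of
vertices is a simplex if the images of its members are pairwise orthogonal. -/
def linkingComplex (k : ℕ) {M : Type u} [AddCommGroup M] (b : Form M) :
    AbstractSimplicialComplex (Hom (stdForm k) b) where
  faces := {s | s.Nonempty ∧
    ∀ f₁ ∈ s, ∀ f₂ ∈ s, f₁ ≠ f₂ → b.AreOrthogonal f₁.range f₂.range}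
  isRelLowerSet_faces := by
    intro s hs
    exact ⟨hs.1, fun t ht hne => ⟨hne, fun f₁ h₁ f₂ h₂ => hs.2 f₁ (ht h₁) f₂ (ht h₂)⟩⟩
  singleton_mem := by
    intro v
    refine ⟨Finset.singleton_nonempty v, fun f₁ h₁ f₂ h₂ hne => ?_⟩
    rw [Finset.mem_singleton] at h₁ h₂
    exact absurd (h₁.trans h₂.symm) hne

end Linking

/-! ### Simplicial complexes: realization, links, connectivity -/

namespace Complexes

/-- The points of the geometric realization, in barycentric coordinates. -/
def Realization {ι : Type u} (K : PreAbstractSimplicialComplex ι) : Type u :=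
  {t : ι →₀ ℝ // (∀ i, 0 ≤ t i) ∧ (∑ i ∈ t.support, t i = 1) ∧ t.support ∈ K.faces}

/-- The closed simplex of `|K|` spanned by `s`. -/
def ClosedSimplex {ι : Type u} (K : PreAbstractSimplicialComplex ι) (s : Finset ι) : Type u :=
  {t : Realization K // t.1.support ⊆ s}

/-- A closed simplex has the topology given by the barycentric coordinates. -/
instance {ι : Type u} (K : PreAbstractSimplicialComplex ι) (s : Finset ι) :
    TopologicalSpace (ClosedSimplex K s) :=
  TopologicalSpace.induced (fun t => (fun i => t.1.1 i : ι → ℝ)) inferInstance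

/-- The weak topology: a subset of `|K|` is open iff its intersection with every closed simplex
is open in that simplex. -/
instance {ι : Type u} (K : PreAbstractSimplicialComplex ι) : TopologicalSpace (Realization K) :=
  ⨆ s : K.faces, TopologicalSpace.coinduced
    (fun t : ClosedSimplex K s.1 => t.1) inferInstance

/-- `c`-connectedness for a rational number `c`: for `c ≥ -1` the space is nonempty, and its
homotopy groups (for `j = 0`: its set of path components) are trivial in all degrees
`0 ≤ j ≤ c`. For `c < -1` there is no condition. -/
def IsNConnected (c : ℚ) (X : Type u) [TopologicalSpace X] : Prop :=
  (-1 ≤ c → Nonempty X) ∧ ∀ j : ℕ, (j : ℚ) ≤ c → ∀ x : X, Subsingleton (HomotopyGroup.Pi j X x)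

/-- The link of `σ`: all simplices disjoint from `σ` that lie with `σ` in a common simplex. -/
def link {ι : Type u} (K : PreAbstractSimplicialComplex ι) (σ : Finset ι) :
    PreAbstractSimplicialComplex ι where
  faces := {ζ | ζ ∈ K.faces ∧ Disjoint ζ σ ∧ ∃ ξ ∈ K.faces, σ ⊆ ξ ∧ ζ ⊆ ξ}
  isRelLowerSet_faces := by
    rintro s ⟨hs, hd, ξ, hξ, hσξ, hsξ⟩
    exact ⟨(K.isRelLowerSet_faces hs).1, fun t ht hne =>
      ⟨(K.isRelLowerSet_faces hs).2 ht hne, hd.mono_left ht, ξ, hξ, hσξ, ht.trans hsξ⟩⟩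

/-- `lCM(K) ≥ n`: the link of every `p`-simplex is `(n - p - 2)`-connected. -/
def LocallyCMGE {ι : Type u} (K : PreAbstractSimplicialComplex ι) (n : ℚ) : Prop :=
  ∀ (p : ℕ) (σ : Finset ι), σ ∈ K.faces → σ.card = p + 1 →
    IsNConnected (n - p - 2) (Realization (link K σ))

end Complexes

end

noncomputable section

open Set

namespace Complexes

/-! ### Extension of maps and connectivity -/

/-- The translate of `ℚ` by `s√2`. These sets are dense in `ℝ` and pairwise disjoint. -/
def shiftedRat (s : ℕ) : Set ℝ := {t | ∃ q : ℚ, t = s * √2 + q}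

lemma eq_of_mem_shiftedRat {r s : ℕ} {t : ℝ} (hr : t ∈ shiftedRat r) (hs : t ∈ shiftedRat s) :
    r = s := by
  obtain ⟨p, hp⟩ := hr
  obtain ⟨q, hq⟩ := hs
  by_contra hne
  have hne' : ((r : ℚ) - s) ≠ 0 := sub_ne_zero.2 (by exact_mod_cast hne)
  have hne'' : ((r : ℝ) - s) ≠ 0 := by exact_mod_cast hne'
  refine irrational_sqrt_two ⟨(q - p) / (r - s), ?_⟩
  push_cast
  rw [div_eq_iff hne'']
  linarith

/-- The points of `ℝ^d` that have a coordinate in each of the first `s` translates of `ℚ`;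
a set of dimension at most `d - s`. -/
def rationalStratum (d s : ℕ) : Set (Fin d → ℝ) := {x | ∀ r < s, ∃ c, x c ∈ shiftedRat r}

lemma rationalStratum_eq_empty {d s : ℕ} (h : d < s) : rationalStratum d s = ∅ := by
  rw [eq_empty_iff_forall_notMem]
  intro x hx
  choose c hc using fun r : Fin s => hx r r.2
  have : Function.Injective c := by
    intro r r' hrr
    have h1 := hc r
    rw [hrr] at h1
    exact Fin.ext (eq_of_mem_shiftedRat h1 (hc r'))
  have := Fintype.card_le_of_injective c this
  simp at this
  omega

/-- Separation of closed sets along the boundaries of a countable cover. -/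
lemma exists_closed_separation {E : Type*} [TopologicalSpace E] {A₁ A₂ D : Set E}
    (hA₁ : IsClosed A₁) (hA₂ : IsClosed A₂) (B K : ℕ → Set E)
    (hB : ∀ i, IsOpen (B i)) (hK : ∀ i, IsClosed (K i)) (hBK : ∀ i, B i ⊆ K i)
    (hD : ∀ i, K i \ B i ⊆ D) (hcov : ∀ x, x ∉ A₁ ∩ A₂ → ∃ i, x ∈ B i)
    (hsmall : ∀ i, Disjoint (K i) A₁ ∨ Disjoint (K i) A₂) :
    ∃ Z₁ Z₂ : Set E, IsClosed Z₁ ∧ IsClosed Z₂ ∧ Z₁ ∪ Z₂ = univ ∧ A₁ ⊆ Z₁ ∧ A₂ ⊆ Z₂ ∧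
      Z₁ ∩ A₂ ⊆ A₁ ∧ Z₂ ∩ A₁ ⊆ A₂ ∧ (Z₁ ∩ Z₂) \ (A₁ ∪ A₂) ⊆ D := by
  classical
  -- the points whose first index in the closed cover is of a prescribed type
  let P : (ℕ → Prop) → Set E := fun t => {x | ∃ i, t i ∧ x ∈ K i ∧ ∀ j < i, x ∉ K j}
  have hloc : ∀ (t : ℕ → Prop) (C : Set E), (∀ i, t i → Disjoint (K i) C) →
      ∀ x ∈ C, ∀ m, x ∈ B m → x ∉ closure (P t) := by
    intro t C ht x hx m hm hcl
    let F : Set E := ⋃ i ∈ {i | i ≤ m ∧ t i}, K i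
    have hF : IsClosed F :=
      ((Set.finite_Iic m).subset fun i hi => hi.1).isClosed_biUnion fun i _ => hK i
    have hxF : x ∉ F := by
      simp only [F, mem_iUnion, not_exists]
      exact fun i hi hxi => disjoint_left.1 (ht i hi.2) hxi hx
    obtain ⟨y, ⟨hyB, hyF⟩, i, hti, hyi, hmin⟩ :=
      mem_closure_iff.1 hcl (B m ∩ Fᶜ) ((hB m).inter hF.isOpen_compl) ⟨hm, hxF⟩
    refine hyF (mem_biUnion (x := i) ⟨?_, hti⟩ hyi)
    by_contra hlt
    exact hmin m (not_le.1 hlt) (hBK m hyB)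
  let t₁ : ℕ → Prop := fun i => Disjoint (K i) A₂
  let t₂ : ℕ → Prop := fun i => ¬ Disjoint (K i) A₂
  have ht₂ : ∀ i, t₂ i → Disjoint (K i) A₁ := fun i hi => (hsmall i).resolve_right hi
  refine ⟨closure (P t₁) ∪ A₁, closure (P t₂) ∪ A₂, isClosed_closure.union hA₁,
    isClosed_closure.union hA₂, ?_, subset_union_right, subset_union_right, ?_, ?_, ?_⟩
  · rw [eq_univ_iff_forall]
    intro x
    by_cases hx : x ∈ A₁ ∩ A₂
    · exact Or.inl (Or.inr hx.1)
    · have hex : ∃ i, x ∈ K i := (hcov x hx).imp fun i hi => hBK i hi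
      by_cases h : Disjoint (K (Nat.find hex)) A₂
      · exact Or.inl (Or.inl (subset_closure
          ⟨_, h, Nat.find_spec hex, fun j hj => Nat.find_min hex hj⟩))
      · exact Or.inr (Or.inl (subset_closure
          ⟨_, h, Nat.find_spec hex, fun j hj => Nat.find_min hex hj⟩))
  · rintro x ⟨h | h, hx⟩
    · by_contra hx1
      obtain ⟨m, hm⟩ := hcov x fun h => hx1 h.1
      exact hloc t₁ A₂ (fun _ h => h) x hx m hm h
    · exact h
  · rintro x ⟨h | h, hx⟩
    · by_contra hx1
      obtain ⟨m, hm⟩ := hcov x fun h => hx1 h.2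
      exact hloc t₂ A₁ ht₂ x hx m hm h
    · exact h
  · rintro x ⟨⟨h1, h2⟩, hx⟩
    have h1 := h1.resolve_right fun h => hx (Or.inl h)
    have h2 := h2.resolve_right fun h => hx (Or.inr h)
    by_contra hxD
    have hex : ∃ i, x ∈ K i := (hcov x fun h => hx (Or.inl h.1)).imp fun i hi => hBK i hi
    set n := Nat.find hex
    have hxn : x ∈ B n := by
      by_contra hn
      exact hxD (hD n ⟨Nat.find_spec hex, hn⟩)
    let F : Set E := ⋃ i ∈ Iio n, K i
    have hF : IsClosed F := (Set.finite_Iio n).isClosed_biUnion fun i _ => hK i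
    have hxF : x ∉ F := by
      simp only [F, mem_iUnion, not_exists]
      exact fun i hi => Nat.find_min hex hi
    have key : ∀ t : ℕ → Prop, x ∈ closure (P t) → t n := by
      intro t ht
      obtain ⟨y, ⟨hyB, hyF⟩, i, hti, hyi, hmin⟩ :=
        mem_closure_iff.1 ht (B n ∩ Fᶜ) ((hB n).inter hF.isOpen_compl) ⟨hxn, hxF⟩
      have hle : ¬ n < i := fun hlt => hmin n hlt (hBK n hyB)
      have hge : ¬ i < n := fun hlt => hyF (mem_biUnion (x := i) hlt hyi)
      obtain rfl : i = n := by omega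
      exact hti
    exact key t₂ h2 (key t₁ h1)

/-- Closed subsets of `ℝ^d` can be separated along faces of boxes with coordinates
in `shiftedRat s`. -/
lemma exists_separation_shiftedRat {d : ℕ} (s : ℕ) {A₁ A₂ : Set (Fin d → ℝ)}
    (hA₁ : IsClosed A₁) (hA₂ : IsClosed A₂) :
    ∃ Z₁ Z₂ : Set (Fin d → ℝ), IsClosed Z₁ ∧ IsClosed Z₂ ∧ Z₁ ∪ Z₂ = univ ∧ A₁ ⊆ Z₁ ∧ A₂ ⊆ Z₂ ∧
      Z₁ ∩ A₂ ⊆ A₁ ∧ Z₂ ∩ A₁ ⊆ A₂ ∧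
      (Z₁ ∩ Z₂) \ (A₁ ∪ A₂) ⊆ {x | ∃ c, x c ∈ shiftedRat s} := by
  classical
  obtain ⟨e, he⟩ := exists_surjective_nat ((Fin d → ℚ) × (Fin d → ℚ))
  let lo : ℕ → Fin d → ℝ := fun n c => s * √2 + ((e n).1 c : ℝ)
  let hi : ℕ → Fin d → ℝ := fun n c => s * √2 + ((e n).2 c : ℝ)
  let good : ℕ → Prop := fun n => Disjoint (Icc (lo n) (hi n)) A₁ ∨ Disjoint (Icc (lo n) (hi n)) A₂
  let K : ℕ → Set (Fin d → ℝ) := fun n => if good n then Icc (lo n) (hi n) else ∅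
  let B : ℕ → Set (Fin d → ℝ) := fun n =>
    if good n then Set.pi univ fun c => Ioo (lo n c) (hi n c) else ∅
  refine exists_closed_separation hA₁ hA₂ B K ?_ ?_ ?_ ?_ ?_ ?_
  · intro n
    by_cases h : good n
    · simp only [B, if_pos h]
      exact isOpen_set_pi finite_univ fun c _ => isOpen_Ioo
    · simp [B, h]
  · intro n
    by_cases h : good n
    · simp only [K, if_pos h]
      exact isClosed_Icc
    · simp [K, h]
  · intro n
    by_cases h : good n
    · simp only [K, B, if_pos h]
      intro x hx
      exact ⟨fun c => (hx c trivial).1.le, fun c => (hx c trivial).2.le⟩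
    · simp [K, B, h]
  · intro n
    by_cases h : good n
    · simp only [K, B, if_pos h]
      rintro x ⟨hx, hx'⟩
      simp only [Set.mem_pi, mem_univ, true_implies, not_forall, mem_Ioo, not_and_or, not_lt] at hx'
      obtain ⟨c, hc | hc⟩ := hx'
      · exact ⟨c, (e n).1 c, le_antisymm hc (hx.1 c)⟩
      · exact ⟨c, (e n).2 c, le_antisymm (hx.2 c) hc⟩
    · simp [K, h]
  · intro x hx
    have : ∃ U : Set (Fin d → ℝ), IsOpen U ∧ x ∈ U ∧ (Disjoint U A₁ ∨ Disjoint U A₂) := by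
      by_cases h1 : x ∈ A₁
      · exact ⟨A₂ᶜ, hA₂.isOpen_compl, fun h2 => hx ⟨h1, h2⟩, Or.inr disjoint_compl_left⟩
      · exact ⟨A₁ᶜ, hA₁.isOpen_compl, h1, Or.inl disjoint_compl_left⟩
    obtain ⟨U, hU, hxU, hUA⟩ := this
    obtain ⟨ε, hε, hball⟩ := Metric.isOpen_iff.1 hU x hxU
    have h1 : ∀ c, ∃ q : ℚ, x c - ε / 2 - s * √2 < q ∧ (q : ℝ) < x c - s * √2 :=
      fun c => exists_rat_btwn (by linarith)
    have h2 : ∀ c, ∃ q : ℚ, x c - s * √2 < q ∧ (q : ℝ) < x c + ε / 2 - s * √2 :=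
      fun c => exists_rat_btwn (by linarith)
    choose p hp using h1
    choose q hq using h2
    obtain ⟨n, hn⟩ := he (p, q)
    have hsub : Icc (lo n) (hi n) ⊆ U := by
      intro y hy
      refine hball ?_
      rw [Metric.mem_ball]
      refine lt_of_le_of_lt ((dist_pi_le_iff (r := ε / 2) (by positivity)).2 fun c => ?_)
        (by linarith)
      have h1 := hy.1 c
      have h2 := hy.2 c
      have h3 := hp c
      have h4 := hq c
      simp only [lo, hi, hn] at h1 h2
      rw [Real.dist_eq, abs_le]
      constructor <;> linarith
    have hgood : good n := hUA.imp (fun h => h.mono_left hsub) fun h => h.mono_left hsub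
    refine ⟨n, ?_⟩
    simp only [B, if_pos hgood]
    intro c _
    have h3 := hp c
    have h4 := hq c
    simp only [lo, hi, hn, mem_Ioo]
    constructor <;> linarith
  · intro n
    by_cases h : good n
    · simp only [K, if_pos h]
      exact h
    · simp [K, h]

lemma exists_continuousOn_union {X Y : Type*} [TopologicalSpace X] [TopologicalSpace Y]
    {S T : Set X} (hS : IsClosed S) (hT : IsClosed T) {f g : X → Y} (hf : ContinuousOn f S)
    (hg : ContinuousOn g T) (h : EqOn f g (S ∩ T)) :
    ∃ k : X → Y, ContinuousOn k (S ∪ T) ∧ EqOn k f S ∧ EqOn k g T := by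
  classical
  have h1 : EqOn (S.piecewise f g) f S := piecewise_eqOn S f g
  have h2 : EqOn (S.piecewise f g) g T := by
    intro x hx
    by_cases hxS : x ∈ S
    · rw [h1 hxS, h ⟨hxS, hx⟩]
    · exact piecewise_eq_of_notMem S f g hxS
  exact ⟨S.piecewise f g, (hf.congr h1).union_of_isClosed (hg.congr h2) hS hT, h1, h2⟩

/-- `X` has the extension property for maps into it from relatively at most
`(m - 1)`-dimensional closed pairs; for polyhedra this amounts to `(m - 2)`-connectedness. -/
def IsExtensor {E : Type*} [TopologicalSpace E] (m : ℕ) (X : Set E) : Prop :=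
  ∀ (d s : ℕ) (Z A : Set (Fin d → ℝ)) (f : (Fin d → ℝ) → E), d + 1 ≤ m + s →
    IsClosed Z → IsClosed A → A ⊆ Z → Z \ A ⊆ rationalStratum d s → ContinuousOn f A →
    MapsTo f A X → ∃ g : (Fin d → ℝ) → E, ContinuousOn g Z ∧ MapsTo g Z X ∧ EqOn g f A

section IsExtensor

variable {E : Type*} [TopologicalSpace E] {X X₁ X₂ : Set E} {m n : ℕ}

lemma isExtensor_zero (X : Set E) : IsExtensor 0 X := by
  intro d s Z A f hds _ _ hAZ hZA hf hfX
  rw [rationalStratum_eq_empty (by omega), subset_empty_iff, sdiff_eq_empty] at hZA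
  obtain rfl := hAZ.antisymm hZA
  exact ⟨f, hf, hfX, fun _ _ => rfl⟩

lemma IsExtensor.mono (h : IsExtensor n X) (hmn : m ≤ n) : IsExtensor m X := by
  intro d s Z A f hds
  exact h d s Z A f (by omega)

lemma IsExtensor.union (h₁ : IsExtensor (m + 1) X₁) (h₂ : IsExtensor (m + 1) X₂)
    (h₁₂ : IsExtensor m (X₁ ∩ X₂)) (hX₁ : IsClosed X₁) (hX₂ : IsClosed X₂) :
    IsExtensor (m + 1) (X₁ ∪ X₂) := by
  intro d s Z A f hds hZ hA hAZ hZA hf hfX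
  have hA₁ : IsClosed (A ∩ f ⁻¹' X₁) := hf.preimage_isClosed_of_isClosed hA hX₁
  have hA₂ : IsClosed (A ∩ f ⁻¹' X₂) := hf.preimage_isClosed_of_isClosed hA hX₂
  set A₁ := A ∩ f ⁻¹' X₁ with hA₁def
  set A₂ := A ∩ f ⁻¹' X₂ with hA₂def
  have hA₁₂ : A₁ ∪ A₂ = A := by
    rw [hA₁def, hA₂def, ← inter_union_distrib_left, inter_eq_left]
    exact hfX
  obtain ⟨Z₁, Z₂, hZ₁, hZ₂, hZu, h11, h22, h12, h21, hD⟩ :=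
    exists_separation_shiftedRat s hA₁ hA₂
  obtain ⟨g, hg, hgX, hgf⟩ := h₁₂ d (s + 1) (Z ∩ (Z₁ ∩ Z₂)) (A₁ ∩ A₂) f (by omega)
    (hZ.inter (hZ₁.inter hZ₂)) (hA₁.inter hA₂)
    (fun x hx => ⟨hAZ hx.1.1, h11 hx.1, h22 hx.2⟩)
    (by
      rintro x ⟨⟨hxZ, hx1, hx2⟩, hxA⟩
      have hxA' : x ∉ A := by
        rw [← hA₁₂]
        rintro (h | h)
        · exact hxA ⟨h, h21 ⟨hx2, h⟩⟩
        · exact hxA ⟨h12 ⟨hx1, h⟩, h⟩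
      intro r hr
      rcases Nat.lt_succ_iff_lt_or_eq.1 hr with hr | rfl
      · exact hZA ⟨hxZ, hxA'⟩ r hr
      · exact hD ⟨⟨hx1, hx2⟩, by rwa [hA₁₂]⟩)
    (hf.mono fun x hx => hx.1.1) (fun x hx => ⟨hx.1.2, hx.2.2⟩)
  have step : ∀ (A' Z' X' : Set _), IsClosed A' → IsClosed Z' → IsExtensor (m + 1) X' →
      A' ⊆ A → A' ⊆ Z' → Z' ∩ A ⊆ A' → MapsTo f A' X' → X₁ ∩ X₂ ⊆ X' →
      A' ∩ (Z₁ ∩ Z₂) ⊆ A₁ ∩ A₂ → Z₁ ∩ Z₂ ⊆ Z' →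
      ∃ g' : (Fin d → ℝ) → E, ContinuousOn g' (Z ∩ Z') ∧ MapsTo g' (Z ∩ Z') X' ∧ EqOn g' f A' ∧
        EqOn g' g (Z ∩ (Z₁ ∩ Z₂)) := by
    intro A' Z' X' hA' hZ' hX' hA'A hA'Z' hZ'A hfA' hXX' hA'' hZZ'
    obtain ⟨k, hk, hkf, hkg⟩ := exists_continuousOn_union hA' (hZ.inter (hZ₁.inter hZ₂))
      (hf.mono hA'A) hg (fun x hx => (hgf (hA'' ⟨hx.1, hx.2.2⟩)).symm)
    obtain ⟨g', hg', hg'X, hg'k⟩ := hX' d s (Z ∩ Z') (A' ∪ Z ∩ (Z₁ ∩ Z₂)) k hds (hZ.inter hZ')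
      (hA'.union (hZ.inter (hZ₁.inter hZ₂)))
      (union_subset (fun x hx => ⟨hAZ (hA'A hx), hA'Z' hx⟩) fun x hx => ⟨hx.1, hZZ' hx.2⟩)
      (fun x hx => hZA ⟨hx.1.1, fun hxA => hx.2 (Or.inl (hZ'A ⟨hx.1.2, hxA⟩))⟩) hk
      (by
        rintro x (hx | hx)
        · rw [hkf hx]; exact hfA' hx
        · rw [hkg hx]; exact hXX' (hgX hx))
    exact ⟨g', hg', hg'X, fun x hx => (hg'k (Or.inl hx)).trans (hkf hx),
      fun x hx => (hg'k (Or.inr hx)).trans (hkg hx)⟩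
  obtain ⟨g₁, hg₁, hg₁X, hg₁f, hg₁g⟩ := step A₁ Z₁ X₁ hA₁ hZ₁ h₁ inter_subset_left h11
    (by
      rintro x ⟨hx, hxA⟩
      rw [← hA₁₂] at hxA
      exact hxA.elim id fun h => h12 ⟨hx, h⟩)
    (fun x hx => hx.2) inter_subset_left (fun x hx => ⟨hx.1, h21 ⟨hx.2.2, hx.1⟩⟩) inter_subset_left
  obtain ⟨g₂, hg₂, hg₂X, hg₂f, hg₂g⟩ := step A₂ Z₂ X₂ hA₂ hZ₂ h₂ inter_subset_left h22
    (by
      rintro x ⟨hx, hxA⟩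
      rw [← hA₁₂] at hxA
      exact hxA.elim (fun h => h21 ⟨hx, h⟩) id)
    (fun x hx => hx.2) inter_subset_right (fun x hx => ⟨h12 ⟨hx.2.1, hx.1⟩, hx.1⟩)
    inter_subset_right
  obtain ⟨k, hk, hk1, hk2⟩ := exists_continuousOn_union (hZ.inter hZ₁) (hZ.inter hZ₂) hg₁ hg₂
    (fun x hx => (hg₁g ⟨hx.1.1, hx.1.2, hx.2.2⟩).trans (hg₂g ⟨hx.1.1, hx.1.2, hx.2.2⟩).symm)
  have hZZ : Z ∩ Z₁ ∪ Z ∩ Z₂ = Z := by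
    rw [← inter_union_distrib_left, hZu, inter_univ]
  rw [hZZ] at hk
  refine ⟨k, hk, ?_, ?_⟩
  · intro x hx
    rw [← hZZ] at hx
    rcases hx with hx | hx
    · rw [hk1 hx]; exact Or.inl (hg₁X hx)
    · rw [hk2 hx]; exact Or.inr (hg₂X hx)
  · intro x hx
    have hx' := hx
    rw [← hA₁₂] at hx'
    rcases hx' with h | h
    · rw [hk1 ⟨hAZ hx, h11 h⟩, hg₁f h]
    · rw [hk2 ⟨hAZ hx, h22 h⟩, hg₂f h]

lemma IsExtensor.nonempty [Nonempty E] (h : IsExtensor 1 X) : X.Nonempty := by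
  obtain ⟨g, -, hg, -⟩ := h 0 0 univ ∅ (fun _ => Classical.arbitrary E) le_rfl isClosed_univ
    isClosed_empty (empty_subset _) (fun x _ r hr => absurd hr (Nat.not_lt_zero r))
    (continuousOn_empty _) (mapsTo_empty _ _)
  exact ⟨g 0, hg trivial⟩

end IsExtensor

end Complexes

namespace Complexes

/-! ### Polyhedra of finite simplicial complexes

Simplicial complexes on a finite vertex set `ι` are treated as lower sets of `Finset ι`;
the empty simplex is allowed as a member. -/

section Polyhedron

variable {ι : Type*} [Fintype ι]

/-- The realization of a lower set of finite sets, inside `ι → ℝ`. -/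
def polyhedron (K : LowerSet (Finset ι)) : Set (ι → ℝ) :=
  {t | (∀ i, 0 ≤ t i) ∧ ∑ i, t i = 1 ∧ ∃ s ∈ K, ∀ i, t i ≠ 0 → i ∈ s}

lemma mem_polyhedron_Iic {s : Finset ι} {t : ι → ℝ} :
    t ∈ polyhedron (LowerSet.Iic s) ↔
      (∀ i, 0 ≤ t i) ∧ ∑ i, t i = 1 ∧ ∀ i, t i ≠ 0 → i ∈ s := by
  refine and_congr_right fun _ => and_congr_right fun _ =>
    ⟨?_, fun h => ⟨s, LowerSet.mem_Iic_iff.2 le_rfl, h⟩⟩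
  rintro ⟨s', hs', h⟩ i hi
  exact hs' (h i hi)

lemma isClosed_polyhedron (K : LowerSet (Finset ι)) : IsClosed (polyhedron K) := by
  have h : polyhedron K = ⋃ s ∈ K, ((⋂ i, {t : ι → ℝ | 0 ≤ t i}) ∩ {t | ∑ i, t i = 1} ∩
      ⋂ i, ⋂ (_ : i ∉ s), {t | t i = 0}) := by
    ext t
    simp only [polyhedron, mem_ofPred_eq, mem_iUnion, mem_inter_iff, mem_iInter, exists_prop]
    constructor
    · rintro ⟨h1, h2, s, hs, h3⟩
      exact ⟨s, hs, ⟨h1, h2⟩, fun i hi => by_contra fun h => hi (h3 i h)⟩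
    · rintro ⟨s, hs, ⟨h1, h2⟩, h3⟩
      exact ⟨h1, h2, s, hs, fun i hi => by_contra fun h => hi (h3 i h)⟩
  rw [h]
  refine (Set.toFinite (K : Set (Finset ι))).isClosed_biUnion fun s _ => ?_
  refine IsClosed.inter (IsClosed.inter ?_ ?_) ?_
  · exact isClosed_iInter fun i => isClosed_le continuous_const (continuous_apply i)
  · exact isClosed_eq (by fun_prop) continuous_const
  · exact isClosed_iInter fun i => isClosed_iInter fun _ =>
      isClosed_eq (continuous_apply i) continuous_const

lemma polyhedron_sup (K L : LowerSet (Finset ι)) :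
    polyhedron (K ⊔ L) = polyhedron K ∪ polyhedron L := by
  ext t
  simp only [polyhedron, mem_ofPred_eq, mem_union, LowerSet.mem_sup_iff]
  constructor
  · rintro ⟨h1, h2, s, hs | hs, h3⟩
    · exact Or.inl ⟨h1, h2, s, hs, h3⟩
    · exact Or.inr ⟨h1, h2, s, hs, h3⟩
  · rintro (⟨h1, h2, s, hs, h3⟩ | ⟨h1, h2, s, hs, h3⟩)
    · exact ⟨h1, h2, s, Or.inl hs, h3⟩
    · exact ⟨h1, h2, s, Or.inr hs, h3⟩

lemma polyhedron_inf (K L : LowerSet (Finset ι)) :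
    polyhedron (K ⊓ L) = polyhedron K ∩ polyhedron L := by
  classical
  ext t
  simp only [polyhedron, mem_ofPred_eq, mem_inter_iff, LowerSet.mem_inf_iff]
  constructor
  · rintro ⟨h1, h2, s, hs, h3⟩
    exact ⟨⟨h1, h2, s, hs.1, h3⟩, ⟨h1, h2, s, hs.2, h3⟩⟩
  · rintro ⟨⟨h1, h2, s, hs, h3⟩, ⟨-, -, s', hs', h3'⟩⟩
    exact ⟨h1, h2, s ∩ s', ⟨K.lower Finset.inter_subset_left hs,
      L.lower Finset.inter_subset_right hs'⟩, fun i hi => Finset.mem_inter.2 ⟨h3 i hi, h3' i hi⟩⟩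

lemma exists_continuous_retraction_simplex {s : Finset ι} (hs : s.Nonempty) :
    ∃ r : (ι → ℝ) → ι → ℝ, Continuous r ∧ (∀ t, r t ∈ polyhedron (LowerSet.Iic s)) ∧
      ∀ t ∈ polyhedron (LowerSet.Iic s), r t = t := by
  classical
  obtain ⟨v, hv⟩ := hs
  -- positive parts, normalized where their sum exceeds `1`, the defect being put on `v`
  let p : (ι → ℝ) → ι → ℝ := fun t i => if i ∈ s then max (t i) 0 else 0
  let S : (ι → ℝ) → ℝ := fun t => ∑ i, p t i
  have hp : ∀ i, Continuous fun t => p t i := by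
    intro i
    by_cases hi : i ∈ s
    · simp only [p, if_pos hi]; fun_prop
    · simp only [p, if_neg hi]; fun_prop
  have hS : Continuous S := continuous_finsetSum _ fun i _ => hp i
  have hp0 : ∀ t i, 0 ≤ p t i := by
    intro t i
    by_cases hi : i ∈ s <;> simp [p, hi]
  have hmax : ∀ t, (0 : ℝ) < max (S t) 1 := fun t => lt_max_of_lt_right one_pos
  refine ⟨fun t i => p t i / max (S t) 1 + if i = v then 1 - S t / max (S t) 1 else 0, ?_, ?_, ?_⟩
  · refine continuous_pi fun i => ((hp i).div (by fun_prop) fun t => (hmax t).ne').add ?_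
    by_cases hi : i = v
    · simp only [if_pos hi]
      exact continuous_const.sub (hS.div (by fun_prop) fun t => (hmax t).ne')
    · simp only [if_neg hi]; fun_prop
  · intro t
    rw [mem_polyhedron_Iic]
    refine ⟨fun i => ?_, ?_, fun i hi => ?_⟩
    · refine add_nonneg (div_nonneg (hp0 t i) (hmax t).le) ?_
      split_ifs
      · rw [sub_nonneg, div_le_one (hmax t)]
        exact le_max_left _ _
      · exact le_rfl
    · rw [Finset.sum_add_distrib, ← Finset.sum_div, Finset.sum_ite_eq' Finset.univ v]
      simp [S]
    · by_contra his
      have hiv : i ≠ v := fun h => his (h ▸ hv)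
      exact hi (by simp [p, his, hiv])
  · intro t ht
    rw [mem_polyhedron_Iic] at ht
    obtain ⟨h1, h2, h3⟩ := ht
    have hpt : p t = t := by
      funext i
      by_cases hi : i ∈ s
      · simp [p, hi, h1 i]
      · have : t i = 0 := by_contra fun h => hi (h3 i h)
        simp [p, hi, this]
    have hSt : S t = 1 := by simp only [S, hpt, h2]
    funext i
    simp [hpt, hSt]

lemma isExtensor_simplex (m : ℕ) {s : Finset ι} (hs : s.Nonempty) :
    IsExtensor m (polyhedron (LowerSet.Iic s)) := by
  obtain ⟨r, hr, hrs, hrt⟩ := exists_continuous_retraction_simplex hs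
  intro d _ Z A f _ _ hA _ _ hf hfX
  obtain ⟨g, hg⟩ := ContinuousMap.exists_restrict_eq hA ⟨A.domRestrict f, hf.domRestrict⟩
  refine ⟨fun x => r (g x), (hr.comp g.continuous).continuousOn, fun x _ => hrs _, fun x hx => ?_⟩
  have : g x = f x := congrArg (fun k => k ⟨x, hx⟩) hg
  simp only [this]
  exact hrt _ (hfX hx)

end Polyhedron

/-! ### Highly connected finite complexes -/

section Combinatorics

variable {ι : Type*} [Fintype ι]

/-- A form of `(m - 2)`-connectedness for finite complexes. -/
def Conn (m : ℕ) (K : LowerSet (Finset ι)) : Prop := IsExtensor m (polyhedron K)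

lemma Conn.mono {m n : ℕ} {K : LowerSet (Finset ι)} (h : Conn n K) (hmn : m ≤ n) : Conn m K :=
  IsExtensor.mono h hmn

lemma conn_zero (K : LowerSet (Finset ι)) : Conn 0 K := isExtensor_zero _

lemma conn_Iic (m : ℕ) {s : Finset ι} (hs : s.Nonempty) : Conn m (LowerSet.Iic s) :=
  isExtensor_simplex m hs

lemma Conn.sup {m : ℕ} {K L : LowerSet (Finset ι)} (hK : Conn m K) (hL : Conn m L)
    (hKL : Conn (m - 1) (K ⊓ L)) : Conn m (K ⊔ L) := by
  rcases m with _ | m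
  · exact conn_zero _
  · rw [Conn, polyhedron_sup]
    rw [Conn, polyhedron_inf] at hKL
    exact IsExtensor.union hK hL hKL (isClosed_polyhedron K) (isClosed_polyhedron L)

variable [DecidableEq ι]

/-- The cone over `L` with apex `v`. -/
def cone (v : ι) (L : LowerSet (Finset ι)) : LowerSet (Finset ι) where
  carrier := {ξ | ξ.erase v ∈ L}
  lower' := fun _ _ h hξ => L.lower (Finset.erase_subset_erase v h) hξ

lemma conn_cone (m : ℕ) (v : ι) (L : LowerSet (Finset ι)) (hL : ∅ ∈ L) : Conn m (cone v L) := by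
  induction hn : (L : Set (Finset ι)).ncard using Nat.strong_induction_on generalizing L m with
  | _ n ih =>
  obtain ⟨σ, hσ⟩ := (Set.toFinite (L : Set (Finset ι))).exists_maximal ⟨∅, hL⟩
  have hcone : cone v (LowerSet.Iic σ) = LowerSet.Iic (insert v σ) := by
    ext ξ
    exact Finset.subset_insert_iff.symm
  by_cases hσ0 : σ = ∅
  · have : L = LowerSet.Iic σ := by
      refine le_antisymm (fun ξ hξ => ?_) (LowerSet.Iic_le.2 hσ.prop)
      have h0 : σ ≤ ξ := by rw [hσ0]; exact Finset.empty_subset ξ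
      exact hσ.2 hξ h0
    rw [this, hcone]
    exact conn_Iic m (Finset.insert_nonempty v σ)
  · let L' : LowerSet (Finset ι) :=
      { carrier := {ξ | ξ ∈ L ∧ ξ ≠ σ}
        lower' := by
          rintro ξ ξ' hle ⟨hξ, hne⟩
          refine ⟨L.lower hle hξ, ?_⟩
          rintro rfl
          exact hne (le_antisymm (hσ.2 hξ hle) hle) }
    have hmem : ∀ ξ, ξ ∈ L' ↔ ξ ∈ L ∧ ξ ≠ σ := fun _ => Iff.rfl
    have hlt : ∀ L'' : LowerSet (Finset ι), L'' ≤ L' → (L'' : Set (Finset ι)).ncard < n := by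
      intro L'' hle
      rw [← hn]
      refine Set.ncard_lt_ncard ⟨fun ξ hξ => (hle hξ).1, fun h => ?_⟩ (Set.toFinite _)
      exact (hle (h hσ.prop)).2 rfl
    have h0 : ∅ ∈ L' := ⟨hL, fun h => hσ0 h.symm⟩
    have hsup : cone v L = cone v L' ⊔ LowerSet.Iic (insert v σ) := by
      rw [← hcone]
      ext ξ
      change ξ.erase v ∈ L ↔ ξ.erase v ∈ L' ∨ ξ.erase v ≤ σ
      constructor
      · intro h
        by_cases he : ξ.erase v = σ
        · exact Or.inr he.le
        · exact Or.inl ⟨h, he⟩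
      · rintro (h | h)
        · exact h.1
        · exact L.lower h hσ.prop
    have hinf : cone v L' ⊓ LowerSet.Iic (insert v σ) = cone v (L' ⊓ LowerSet.Iic σ) := by
      rw [← hcone]
      rfl
    rw [hsup]
    refine Conn.sup (ih _ (hlt _ le_rfl) _ _ h0 rfl) (conn_Iic m (Finset.insert_nonempty v σ)) ?_
    rw [hinf]
    exact ih _ (hlt _ inf_le_left) _ _ ⟨h0, Finset.empty_subset σ⟩ rfl

/-- The join of the full simplex on `σ` with `L`. -/
def simplexJoin (σ : Finset ι) (L : LowerSet (Finset ι)) : LowerSet (Finset ι) where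
  carrier := {ξ | ξ \ σ ∈ L}
  lower' := fun _ _ h hξ => L.lower (Finset.sdiff_subset_sdiff h le_rfl) hξ

/-- The join of the boundary of the simplex on `σ` with `L`. -/
def boundaryJoin (σ : Finset ι) (L : LowerSet (Finset ι)) : LowerSet (Finset ι) where
  carrier := {ξ | ξ \ σ ∈ L ∧ ¬ σ ⊆ ξ}
  lower' := fun _ _ h hξ => ⟨L.lower (Finset.sdiff_subset_sdiff h le_rfl) hξ.1,
    fun h' => hξ.2 (h'.trans h)⟩

lemma conn_simplexJoin (m : ℕ) {σ : Finset ι} (hσ : σ.Nonempty) {L : LowerSet (Finset ι)}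
    (hL : ∅ ∈ L) : Conn m (simplexJoin σ L) := by
  obtain ⟨v, hv⟩ := hσ
  have : simplexJoin σ L = cone v (simplexJoin σ L) := by
    ext ξ
    change ξ \ σ ∈ L ↔ ξ.erase v \ σ ∈ L
    rw [Finset.erase_sdiff_comm, Finset.erase_eq_of_notMem (by simp [hv])]
  rw [this]
  refine conn_cone m v _ ?_
  change ∅ \ σ ∈ L
  simpa using hL

lemma conn_boundaryJoin {m : ℕ} {σ : Finset ι} (hσ : σ.Nonempty) {L : LowerSet (Finset ι)}
    (hL : ∅ ∈ L) (hd : ∀ τ ∈ L, Disjoint τ σ) (h : Conn (m + 1 - σ.card) L) :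
    Conn m (boundaryJoin σ L) := by
  induction hσ using Finset.Nonempty.cons_induction generalizing m with
  | singleton v =>
    have : boundaryJoin {v} L = L := by
      ext ξ
      change ξ \ {v} ∈ L ∧ ¬ {v} ⊆ ξ ↔ ξ ∈ L
      rw [Finset.singleton_subset_iff, Finset.sdiff_singleton_eq_erase]
      constructor
      · rintro ⟨h1, h2⟩
        rwa [Finset.erase_eq_of_notMem h2] at h1
      · intro h1
        have h2 : v ∉ ξ := Finset.disjoint_singleton_right.1 (hd ξ h1)
        exact ⟨by rwa [Finset.erase_eq_of_notMem h2], h2⟩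
    rw [this]
    simpa using h
  | cons v τ hv hτ ih =>
    have hdv : ∀ ξ ∈ L, v ∉ ξ := fun ξ hξ h =>
      Finset.disjoint_left.1 (hd ξ hξ) h (Finset.mem_cons_self v τ)
    have hdτ : ∀ ξ ∈ L, Disjoint ξ τ := fun ξ hξ =>
      (hd ξ hξ).mono_right (Finset.subset_cons hv)
    rcases m with _ | m
    · exact conn_zero _
    rw [Finset.card_cons] at h
    have hbd : ∅ ∈ boundaryJoin τ L := by
      refine ⟨by simpa using hL, fun h => ?_⟩
      exact hτ.ne_empty (Finset.subset_empty.1 h)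
    have hA : ∀ ξ, ξ \ τ ∈ L → v ∉ ξ := fun ξ hξ hvξ =>
      hdv _ hξ (Finset.mem_sdiff.2 ⟨hvξ, hv⟩)
    have herase : ∀ ξ : Finset ι, ξ \ Finset.cons v τ hv = ξ.erase v \ τ := by
      intro ξ
      ext x
      simp only [Finset.mem_sdiff, Finset.mem_cons, Finset.mem_erase]
      tauto
    have hsup : boundaryJoin (Finset.cons v τ hv) L =
        simplexJoin τ L ⊔ cone v (boundaryJoin τ L) := by
      ext ξ
      change ξ \ Finset.cons v τ hv ∈ L ∧ ¬ Finset.cons v τ hv ⊆ ξ ↔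
        ξ \ τ ∈ L ∨ (ξ.erase v \ τ ∈ L ∧ ¬ τ ⊆ ξ.erase v)
      rw [herase, Finset.cons_subset, Finset.subset_erase]
      constructor
      · rintro ⟨h1, h2⟩
        by_cases hvξ : v ∈ ξ
        · exact Or.inr ⟨h1, fun h => h2 ⟨hvξ, h.1⟩⟩
        · rw [Finset.erase_eq_of_notMem hvξ] at h1
          exact Or.inl h1
      · rintro (h1 | ⟨h1, h2⟩)
        · have hvξ := hA ξ h1
          rw [Finset.erase_eq_of_notMem hvξ]
          exact ⟨h1, fun h => hvξ h.1⟩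
        · exact ⟨h1, fun h => h2 ⟨h.2, hv⟩⟩
    have hinf : simplexJoin τ L ⊓ cone v (boundaryJoin τ L) = boundaryJoin τ L := by
      ext ξ
      change (ξ \ τ ∈ L ∧ (ξ.erase v \ τ ∈ L ∧ ¬ τ ⊆ ξ.erase v)) ↔ ξ \ τ ∈ L ∧ ¬ τ ⊆ ξ
      refine and_congr_right fun h1 => ?_
      rw [Finset.erase_eq_of_notMem (hA ξ h1)]
      exact and_iff_right h1
    rw [hsup]
    refine Conn.sup (conn_simplexJoin _ hτ hL) (conn_cone _ v _ hbd) ?_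
    rw [hinf]
    exact ih hdτ (h.mono (by omega))

/-- The part with vertices in `V` of the link of `σ` in `X`. -/
def linkWithin (X : LowerSet (Finset ι)) (V : Set ι) (σ : Finset ι) : LowerSet (Finset ι) where
  carrier := {τ | (∀ x ∈ τ, x ∈ V) ∧ τ ∪ σ ∈ X}
  lower' := fun _ _ h hτ => ⟨fun x hx => hτ.1 x (h hx),
    X.lower (Finset.union_subset_union_left h) hτ.2⟩

/-- A complex `X` is highly connected if it is obtained from a highly connected complex `T` by
adding simplices `σ` outside a set `V` of vertices, together with their joins with simplices
in `V`, if the parts in `V` of the links of these `σ` are sufficiently connected. -/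
lemma conn_of_linkWithin {m : ℕ} (V : Set ι) (X T : LowerSet (Finset ι)) (hTX : T ≤ X)
    (h0 : ∅ ∈ T) (hsat : ∀ ξ ∈ X, ∀ σ ∈ T, (∀ x ∈ ξ, x ∉ V → x ∈ σ) → ξ ∈ T) (hT : Conn m T)
    (h : ∀ σ ∈ X, σ ∉ T → (∀ x ∈ σ, x ∉ V) → Conn (m - σ.card) (linkWithin X V σ)) :
    Conn m X := by
  classical
  induction hn : ((X : Set (Finset ι)) \ T).ncard using Nat.strong_induction_on
    generalizing T with
  | _ n ih =>
  by_cases hTX' : X ≤ T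
  · rwa [← hTX.antisymm hTX']
  let S : Set (Finset ι) := {σ | σ ∈ X ∧ σ ∉ T ∧ ∀ x ∈ σ, x ∉ V}
  have hS : S.Nonempty := by
    obtain ⟨ξ, hξX, hξT⟩ := Set.not_subset.1 hTX'
    refine ⟨ξ.filter (· ∉ V), X.lower (Finset.filter_subset _ _) hξX, fun hT' => hξT ?_, ?_⟩
    · exact hsat ξ hξX _ hT' fun x hx hxV => Finset.mem_filter.2 ⟨hx, hxV⟩
    · exact fun x hx => (Finset.mem_filter.1 hx).2
  obtain ⟨σ, hσ⟩ := (Set.toFinite S).exists_minimal hS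
  obtain ⟨hσX, hσT, hσV⟩ := hσ.prop
  have hproper : ∀ σ' ⊆ σ, σ' ≠ σ → σ' ∈ T := by
    intro σ' hle hne
    by_contra hσ'T
    exact hne (le_antisymm hle
      (hσ.2 ⟨X.lower hle hσX, hσ'T, fun x hx => hσV x (hle hx)⟩ hle))
  have hσ0 : σ.Nonempty := Finset.nonempty_iff_ne_empty.2 fun h => hσT (h ▸ h0)
  set L := linkWithin X V σ
  have hL0 : ∅ ∈ L := ⟨by simp, by simpa using hσX⟩
  have hLσ : ∀ τ ∈ L, Disjoint τ σ := fun τ hτ =>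
    Finset.disjoint_left.2 fun x hx hxσ => hσV x hxσ (hτ.1 x hx)
  have hJX : simplexJoin σ L ≤ X := by
    intro ξ hξ
    refine X.lower ?_ hξ.2
    rw [Finset.sdiff_union_self_eq_union]
    exact Finset.subset_union_left
  have hJT : ∀ ξ ∈ X, (∀ x ∈ ξ, x ∉ V → x ∈ σ) → ¬ σ ⊆ ξ → ξ ∈ T := by
    intro ξ hξ hξV hσξ
    refine hsat ξ hξ (ξ ∩ σ) (hproper _ Finset.inter_subset_right fun h => ?_)
      fun x hx hxV => Finset.mem_inter.2 ⟨hx, hξV x hx hxV⟩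
    exact hσξ (Finset.inter_eq_right.1 h)
  have hinJ : ∀ ξ ∈ simplexJoin σ L, ∀ x ∈ ξ, x ∉ V → x ∈ σ := by
    intro ξ hξ x hx hxV
    by_contra hxσ
    exact hxV (hξ.1 x (Finset.mem_sdiff.2 ⟨hx, hxσ⟩))
  have hinf : T ⊓ simplexJoin σ L = boundaryJoin σ L := by
    ext ξ
    constructor
    · rintro ⟨h1, h2⟩
      exact ⟨h2, fun h => hσT (T.lower h h1)⟩
    · rintro ⟨h1, h2⟩
      exact ⟨hJT ξ (hJX h1) (hinJ ξ h1) h2, h1⟩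
  have hσJ : σ ∈ simplexJoin σ L := by
    change σ \ σ ∈ L
    rwa [Finset.sdiff_self]
  refine ih _ ?_ (T ⊔ simplexJoin σ L) (sup_le hTX hJX) (Or.inl h0) ?_ ?_ ?_ rfl
  · rw [← hn]
    refine Set.ncard_lt_ncard ⟨fun ξ hξ => ⟨hξ.1, fun h => hξ.2 (Or.inl h)⟩, fun h => ?_⟩
      (Set.toFinite _)
    exact (h ⟨hσX, hσT⟩).2 (Or.inr hσJ)
  · rintro ξ hξ σ' (hσ' | hσ') hξσ'
    · exact Or.inl (hsat ξ hξ σ' hσ' hξσ')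
    · have hξσ : ∀ x ∈ ξ, x ∉ V → x ∈ σ := fun x hx hxV => hinJ σ' hσ' x (hξσ' x hx hxV) hxV
      by_cases hsub : σ ⊆ ξ
      · refine Or.inr ⟨fun x hx => ?_, ?_⟩
        · by_contra hxV
          exact (Finset.mem_sdiff.1 hx).2 (hξσ x (Finset.mem_sdiff.1 hx).1 hxV)
        · rwa [Finset.sdiff_union_of_subset hsub]
      · exact Or.inl (hJT ξ hξ hξσ hsub)
  · refine Conn.sup hT (conn_simplexJoin m hσ0 hL0) ?_
    rw [hinf]
    rcases m with _ | m
    · exact conn_zero _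
    · exact conn_boundaryJoin hσ0 hL0 hLσ (h σ hσX hσT hσV)
  · exact fun σ' hσ' hσ'T => h σ' hσ' fun hT' => hσ'T (Or.inl hT')

end Combinatorics

end Complexes

namespace Linking

/-! ### Symplectic families in linking forms -/

/-- The element `1/k` of `ℚ/ℤ`. -/
def invK (k : ℕ) : QModZ := ((1 / k : ℚ) : QModZ)

lemma divByK_intCast (k : ℕ) (n : ℤ) : divByK k (n : ZMod k) = n • invK k := by
  simp [divByK, invK]

lemma zsmul_invK_eq_zero_iff {k : ℕ} (hk : 0 < k) (n : ℤ) : n • invK k = 0 ↔ (k : ℤ) ∣ n := by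
  have : addOrderOf (invK k) = k := AddCircle.addOrderOf_period_div (p := (1 : ℚ)) hk
  rw [← addOrderOf_dvd_iff_zsmul_eq_zero, this]

lemma invK_ne_zero {k : ℕ} (hk : 2 ≤ k) : invK k ≠ 0 := by
  intro h
  have := (zsmul_invK_eq_zero_iff (k := k) (by omega) 1).1 (by rw [h, smul_zero])
  have := Int.le_of_dvd one_pos this
  omega

lemma exists_zsmul_invK {k : ℕ} (hk : 0 < k) {y : QModZ} (hy : k • y = 0) :
    ∃ n : ℤ, y = n • invK k := by
  have hk' : (k : ℚ) ≠ 0 := by exact_mod_cast hk.ne'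
  obtain ⟨q, rfl⟩ := QuotientAddGroup.mk_surjective y
  change k • (q : QModZ) = 0 at hy
  rw [← AddCircle.coe_nsmul, AddCircle.coe_eq_zero_iff] at hy
  obtain ⟨n, hn⟩ := hy
  refine ⟨n, ?_⟩
  rw [invK, ← AddCircle.coe_zsmul]
  congr 1
  simp only [zsmul_eq_mul, mul_one, nsmul_eq_mul] at hn ⊢
  rw [hn]
  field_simp

lemma exists_unimodular_combination_eq_zero {k : ℕ} (hk : 0 < k) {x y : QModZ} (hx : k • x = 0)
    (hy : k • y = 0) : ∃ p q r s : ℤ, p * s - q * r = 1 ∧ p • x + q • y = 0 := by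
  obtain ⟨u, rfl⟩ := exists_zsmul_invK hk hx
  obtain ⟨v, rfl⟩ := exists_zsmul_invK hk hy
  rcases Nat.eq_zero_or_pos (Int.gcd u v) with h0 | hpos
  · rw [Int.gcd_eq_zero_iff] at h0
    exact ⟨1, 0, 0, 1, by norm_num, by simp [h0.1]⟩
  · obtain ⟨u', v', hco, hu, hv⟩ := Int.exists_gcd_one hpos
    obtain ⟨s, t, hst⟩ := Int.isCoprime_iff_gcd_eq_one.2 hco
    refine ⟨v', -u', s, t, by linarith, ?_⟩
    generalize Int.gcd u v = n at hu hv
    rw [hu, hv]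
    module

variable {M : Type*} [AddCommGroup M] {k : ℕ} {b : Form M}

/-- The families `ρ` and `σ` are the images of the standard generators under a morphism from a
sum of copies of the standard form. -/
structure IsSymplectic (k : ℕ) (b : Form M) {ι : Type*} [DecidableEq ι] (ρ σ : ι → M) : Prop where
  nsmul_left : ∀ i, k • ρ i = 0
  nsmul_right : ∀ i, k • σ i = 0
  left_left : ∀ i j, b (ρ i) (ρ j) = 0
  right_right : ∀ i j, b (σ i) (σ j) = 0
  left_right : ∀ i j, b (ρ i) (σ j) = if i = j then invK k else 0

namespace IsSymplectic

variable {ι : Type*} [DecidableEq ι] {ρ σ : ι → M}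

lemma right_left (hb : b.IsStrictlySkew) (h : IsSymplectic k b ρ σ) (i j : ι) :
    b (σ i) (ρ j) = if i = j then -invK k else 0 := by
  rw [hb.skew, h.left_right]
  by_cases hij : i = j
  · simp [hij]
  · simp [hij, Ne.symm hij]

lemma comp {κ : Type*} [DecidableEq κ] (h : IsSymplectic k b ρ σ) {e : κ → ι}
    (he : Function.Injective e) : IsSymplectic k b (ρ ∘ e) (σ ∘ e) where
  nsmul_left i := h.nsmul_left _
  nsmul_right i := h.nsmul_right _
  left_left i j := h.left_left _ _
  right_right i j := h.right_right _ _
  left_right i j := by simp [h.left_right, he.eq_iff]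

/-- Change of basis in one hyperbolic pair. -/
lemma update_pair (hb : b.IsStrictlySkew) (h : IsSymplectic k b ρ σ) (j : ι) {p q r s : ℤ}
    (hdet : p * s - q * r = 1) :
    IsSymplectic k b (Function.update ρ j (p • ρ j + q • σ j))
      (Function.update σ j (r • ρ j + s • σ j)) := by
  have hx : ∀ (m : ℤ) (x : M), k • x = 0 → k • m • x = 0 := fun m x hx => by
    rw [smul_comm, hx, smul_zero]
  constructor
  · intro i
    rcases eq_or_ne i j with rfl | hi
    · simp [hx _ _ (h.nsmul_left i), hx _ _ (h.nsmul_right i)]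
    · simp [hi, h.nsmul_left]
  · intro i
    rcases eq_or_ne i j with rfl | hi
    · simp [hx _ _ (h.nsmul_left i), hx _ _ (h.nsmul_right i)]
    · simp [hi, h.nsmul_right]
  · intro i i'
    rcases eq_or_ne i j with rfl | hi <;> rcases eq_or_ne i' i with rfl | hi'
    · exact hb.self_eq_zero _
    · simp [hi', hi'.symm, h.left_left, h.right_left hb]
    · exact hb.self_eq_zero _
    · rcases eq_or_ne i' j with rfl | hj
      · simp [hi, h.left_left, h.left_right]
      · simp [hi, hj, h.left_left]
  · intro i i'
    rcases eq_or_ne i j with rfl | hi <;> rcases eq_or_ne i' i with rfl | hi'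
    · exact hb.self_eq_zero _
    · simp [hi', hi'.symm, h.right_right, h.left_right]
    · exact hb.self_eq_zero _
    · rcases eq_or_ne i' j with rfl | hj
      · simp [hi, h.right_right, h.right_left hb]
      · simp [hi, hj, h.right_right]
  · intro i i'
    rcases eq_or_ne i j with rfl | hi <;> rcases eq_or_ne i' i with rfl | hi'
    · simp only [Function.update_self, map_add, map_zsmul, AddMonoidHom.add_apply,
        AddMonoidHom.zsmul_apply, h.left_left, h.right_right, h.left_right, h.right_left hb,
        if_true]
      nth_rw 3 [← one_smul ℤ (invK k)]
      rw [← hdet]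
      module
    · simp [hi', hi'.symm, h.left_right, h.right_right]
    · simp [hi, h.left_right]
    · rcases eq_or_ne i' j with rfl | hj
      · simp [hi, h.left_left, h.left_right]
      · simp [hi, hj, h.left_right]

/-- Change of basis mixing two hyperbolic pairs. -/
lemma update_two_pairs (h : IsSymplectic k b ρ σ) {i j : ι} (hij : i ≠ j)
    {p q r s : ℤ} (hdet : p * s - q * r = 1) :
    IsSymplectic k b
      (Function.update (Function.update ρ i (s • ρ i - r • ρ j)) j (p • ρ j - q • ρ i))
      (Function.update (Function.update σ i (p • σ i + q • σ j)) j (r • σ i + s • σ j)) := by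
  have hx : ∀ (m : ℤ) (x : M), k • x = 0 → k • m • x = 0 := fun m x hx => by
    rw [smul_comm, hx, smul_zero]
  have key : ∀ z : ι, z = j ∨ z = i ∧ z ≠ j ∨ z ≠ i ∧ z ≠ j := by
    intro z
    by_cases h1 : z = j
    · exact Or.inl h1
    · by_cases h2 : z = i
      · exact Or.inr (Or.inl ⟨h2, h1⟩)
      · exact Or.inr (Or.inr ⟨h2, h1⟩)
  constructor
  · intro z
    rcases key z with rfl | ⟨rfl, h1⟩ | ⟨h1, h2⟩ <;>
      simp [*, smul_sub, h.nsmul_left]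
  · intro z
    rcases key z with rfl | ⟨rfl, h1⟩ | ⟨h1, h2⟩ <;>
      simp [*, smul_add, h.nsmul_right]
  · intro z w
    rcases key z with rfl | ⟨rfl, h1⟩ | ⟨h1, h2⟩ <;>
    rcases key w with rfl | ⟨rfl, h3⟩ | ⟨h3, h4⟩ <;>
      simp [*, h.left_left]
  · intro z w
    rcases key z with rfl | ⟨rfl, h1⟩ | ⟨h1, h2⟩ <;>
    rcases key w with rfl | ⟨rfl, h3⟩ | ⟨h3, h4⟩ <;>
      simp [*, h.right_right]
  · have hdet1 : s • p • invK k - r • q • invK k = invK k := by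
      nth_rw 3 [← one_smul ℤ (invK k)]
      rw [← hdet]
      module
    have hdet2 : p • s • invK k - q • r • invK k = invK k := by
      nth_rw 3 [← one_smul ℤ (invK k)]
      rw [← hdet]
      module
    intro z w
    rcases key z with rfl | ⟨rfl, h1⟩ | ⟨h1, h2⟩ <;>
    rcases key w with rfl | ⟨rfl, h3⟩ | ⟨h3, h4⟩ <;>
      simp_all [h.left_right, Ne.symm, smul_comm r s, smul_comm p q]

/-- A symplectic family can be changed such that a functional vanishes on all pairs
but one. -/
lemma exists_forall_eq_zero (hk : 0 < k) (hb : b.IsStrictlySkew) (h : IsSymplectic k b ρ σ)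
    {N : AddSubgroup M} (hN : ∀ i, ρ i ∈ N ∧ σ i ∈ N) (l : M →+ QModZ) (i : ι) (S : Finset ι)
    (hi : i ∉ S) : ∃ ρ' σ' : ι → M, IsSymplectic k b ρ' σ' ∧ (∀ j, ρ' j ∈ N ∧ σ' j ∈ N) ∧
      ∀ j ∈ S, l (ρ' j) = 0 ∧ l (σ' j) = 0 := by
  have hl : ∀ x, k • x = 0 → k • l x = 0 := fun x hx => by rw [← map_nsmul, hx, map_zero]
  have hNu : ∀ (f : ι → M) (j : ι) (x : M), (∀ z, f z ∈ N) → x ∈ N →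
      ∀ z, Function.update f j x z ∈ N := by
    intro f j x hf hx z
    rcases eq_or_ne z j with rfl | hz
    · simpa using hx
    · simpa [hz] using hf z
  -- a single pair can be changed such that `l` vanishes on its first member
  have step : ∀ (ρ σ : ι → M), IsSymplectic k b ρ σ → (∀ j, ρ j ∈ N ∧ σ j ∈ N) → ∀ j,
      ∃ ρ' σ' : ι → M, IsSymplectic k b ρ' σ' ∧ (∀ j, ρ' j ∈ N ∧ σ' j ∈ N) ∧
      l (ρ' j) = 0 ∧ ∀ z, z ≠ j → ρ' z = ρ z ∧ σ' z = σ z := by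
    intro ρ σ h hN j
    obtain ⟨p, q, r, s, hdet, h0⟩ := exists_unimodular_combination_eq_zero hk
      (hl _ (h.nsmul_left j)) (hl _ (h.nsmul_right j))
    refine ⟨_, _, h.update_pair hb j hdet, fun z => ⟨?_, ?_⟩, ?_, ?_⟩
    · exact hNu _ _ _ (fun z => (hN z).1)
        (add_mem (zsmul_mem (hN j).1 _) (zsmul_mem (hN j).2 _)) z
    · exact hNu _ _ _ (fun z => (hN z).2)
        (add_mem (zsmul_mem (hN j).1 _) (zsmul_mem (hN j).2 _)) z
    · simpa using h0
    · intro z hz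
      simp [hz]
  induction S using Finset.induction_on with
  | empty => exact ⟨ρ, σ, h, hN, by simp⟩
  | insert j S hj ih =>
    obtain ⟨ρ₁, σ₁, h₁, hN₁, hS₁⟩ := ih fun h => hi (Finset.mem_insert_of_mem h)
    have hij : i ≠ j := fun h => hi (h ▸ Finset.mem_insert_self j S)
    obtain ⟨ρ₂, σ₂, h₂, hN₂, hl₂, heq₂⟩ := step ρ₁ σ₁ h₁ hN₁ j
    obtain ⟨ρ₃, σ₃, h₃, hN₃, hl₃, heq₃⟩ := step ρ₂ σ₂ h₂ hN₂ i
    have hl₃' : l (ρ₃ j) = 0 := by rw [(heq₃ j hij.symm).1, hl₂]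
    obtain ⟨p, q, r, s, hdet, h0⟩ := exists_unimodular_combination_eq_zero hk
      (hl _ (h₃.nsmul_right j)) (hl _ (h₃.nsmul_right i))
    refine ⟨_, _, h₃.update_two_pairs hij.symm hdet, fun z => ⟨?_, ?_⟩, ?_⟩
    · refine hNu _ _ _ (hNu _ _ _ (fun z => (hN₃ z).1) ?_) ?_ z
      · exact sub_mem (zsmul_mem (hN₃ j).1 _) (zsmul_mem (hN₃ i).1 _)
      · exact sub_mem (zsmul_mem (hN₃ i).1 _) (zsmul_mem (hN₃ j).1 _)
    · refine hNu _ _ _ (hNu _ _ _ (fun z => (hN₃ z).2) ?_) ?_ z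
      · exact add_mem (zsmul_mem (hN₃ j).2 _) (zsmul_mem (hN₃ i).2 _)
      · exact add_mem (zsmul_mem (hN₃ j).2 _) (zsmul_mem (hN₃ i).2 _)
    · intro z hz
      have hzi : z ≠ i := fun h => hi (h ▸ hz)
      rcases Finset.mem_insert.1 hz with rfl | hz
      · simp [hzi, hl₃, hl₃', h0]
      · have hzj : z ≠ j := fun h => hj (h ▸ hz)
        simp only [Function.update_of_ne hzi, Function.update_of_ne hzj]
        rw [(heq₃ z hzi).1, (heq₃ z hzi).2, (heq₂ z hzj).1, (heq₂ z hzj).2]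
        exact hS₁ z hz

end IsSymplectic

/-- The subgroup `N` contains a symplectic family of size `g`. -/
def HasRank (k : ℕ) (b : Form M) (N : AddSubgroup M) (g : ℕ) : Prop :=
  ∃ ρ σ : Fin g → M, IsSymplectic k b ρ σ ∧ ∀ i, ρ i ∈ N ∧ σ i ∈ N

lemma HasRank.mono {N : AddSubgroup M} {g g' : ℕ} (h : HasRank k b N g) (hg : g' ≤ g) :
    HasRank k b N g' := by
  obtain ⟨ρ, σ, h, hN⟩ := h
  exact ⟨_, _, h.comp (Fin.castLE_injective hg), fun i => hN _⟩

/-- The kernel of a functional. -/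
lemma HasRank.inf_ker (hk : 0 < k) (hb : b.IsStrictlySkew) {N : AddSubgroup M} {g : ℕ}
    (h : HasRank k b N g) (l : M →+ QModZ) : HasRank k b (N ⊓ l.ker) (g - 1) := by
  rcases g with _ | g
  · obtain ⟨ρ, σ, h, -⟩ := h
    exact ⟨ρ, σ, h, fun i => i.elim0⟩
  · obtain ⟨ρ, σ, h, hN⟩ := h
    obtain ⟨ρ', σ', h', hN', hl⟩ := h.exists_forall_eq_zero hk hb hN l (Fin.last g)
      (Finset.univ.erase (Fin.last g)) (by simp)
    refine ⟨_, _, h'.comp (Fin.castSucc_injective g), fun i => ?_⟩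
    have := hl i.castSucc (by simp)
    exact ⟨⟨(hN' _).1, this.1⟩, ⟨(hN' _).2, this.2⟩⟩

/-- Projection along a vector in the radical of `N`. -/
lemma HasRank.inf_ker_of_radical (hk : 0 < k) (hb : b.IsStrictlySkew) {N : AddSubgroup M} {g : ℕ}
    (h : HasRank k b N g) {x y : M} (hx : x ∈ N) (hkx : k • x = 0) (hxN : ∀ z ∈ N, b x z = 0)
    (hxy : b x y = invK k) : HasRank k b (N ⊓ (b y).ker) g := by
  obtain ⟨ρ, σ, h, hN⟩ := h
  have hNx : ∀ z ∈ N, b z x = 0 := fun z hz => by rw [hb.skew, hxN z hz, neg_zero]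
  have hyx : b y x = -invK k := by rw [hb.skew, hxy]
  have hcoef : ∀ z, k • z = 0 → ∃ n : ℤ, b y z = n • invK k := fun z hz =>
    exists_zsmul_invK hk (by rw [← map_nsmul, hz, map_zero])
  choose u hu using fun i => hcoef (ρ i) (h.nsmul_left i)
  choose v hv using fun i => hcoef (σ i) (h.nsmul_right i)
  have hkx' : ∀ m : ℤ, k • m • x = 0 := fun m => by rw [smul_comm, hkx, smul_zero]
  refine ⟨fun i => ρ i + u i • x, fun i => σ i + v i • x, ⟨?_, ?_, ?_, ?_, ?_⟩, ?_⟩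
  · intro i; simp [h.nsmul_left, hkx']
  · intro i; simp [h.nsmul_right, hkx']
  · intro i j
    simp [h.left_left, hNx _ (hN i).1, hxN _ (hN j).1, hxN x hx]
  · intro i j
    simp [h.right_right, hNx _ (hN i).2, hxN _ (hN j).2, hxN x hx]
  · intro i j
    simp [h.left_right, hNx _ (hN i).1, hxN _ (hN j).2, hxN x hx]
  · intro i
    refine ⟨⟨add_mem (hN i).1 (zsmul_mem hx _), ?_⟩, ⟨add_mem (hN i).2 (zsmul_mem hx _), ?_⟩⟩
    · simp [hu, hyx]
    · simp [hv, hyx]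

end Linking

namespace Complexes

/-! ### Realizations of finite complexes -/

section Realization

open scoped unitInterval

variable {ι : Type*}

/-- The barycentric coordinates of a point. -/
def Realization.coords {P : PreAbstractSimplicialComplex ι} (x : Realization P) : ι → ℝ :=
  fun i => x.1 i

lemma Realization.coords_injective (P : PreAbstractSimplicialComplex ι) :
    Function.Injective (Realization.coords (P := P)) :=
  fun _ _ h => Subtype.ext (DFunLike.coe_injective h)

/-- A complex and a lower set have the same nonempty simplices. -/
def SameFaces (P : PreAbstractSimplicialComplex ι) (K : LowerSet (Finset ι)) : Prop :=
  ∀ s : Finset ι, s ∈ P.faces ↔ s.Nonempty ∧ s ∈ K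

variable [Fintype ι]

lemma range_coords {P : PreAbstractSimplicialComplex ι} {K : LowerSet (Finset ι)}
    (h : SameFaces P K) : range (Realization.coords (P := P)) = polyhedron K := by
  classical
  ext t
  constructor
  · rintro ⟨x, rfl⟩
    obtain ⟨t, h1, h2, h3⟩ := x
    refine ⟨h1, ?_, t.support, ((h _).1 h3).2, fun i hi => Finsupp.mem_support_iff.2 hi⟩
    exact (Finset.sum_subset (Finset.subset_univ _) fun i _ hi =>
      Finsupp.notMem_support_iff.1 hi).symm.trans h2
  · rintro ⟨h1, h2, s, hs, h3⟩
    let u : ι →₀ ℝ := Finsupp.equivFunOnFinite.symm t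
    have hu : ∀ i, u i = t i := fun i => rfl
    have hsum : ∑ i ∈ u.support, u i = 1 := by
      rw [← h2]
      exact Finset.sum_subset (Finset.subset_univ _) fun i _ hi => Finsupp.notMem_support_iff.1 hi
    refine ⟨⟨u, h1, hsum, (h _).2 ⟨?_, K.lower (fun i hi => ?_) hs⟩⟩, rfl⟩
    · rw [Finset.nonempty_iff_ne_empty]
      intro h0
      rw [h0, Finset.sum_empty] at hsum
      exact zero_ne_one hsum
    · exact h3 i (Finsupp.mem_support_iff.1 hi)

lemma isClosedEmbedding_coords (P : PreAbstractSimplicialComplex ι) :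
    Topology.IsClosedEmbedding (Realization.coords (P := P)) := by
  refine Topology.IsClosedEmbedding.of_continuous_injective_isClosedMap ?_
    (Realization.coords_injective P) ?_
  · refine continuous_iSup_dom.2 fun s => continuous_coinduced_dom.2 ?_
    exact continuous_induced_dom
  · intro C hC
    have hcl : ∀ s ∈ P.faces, IsClosed (Realization.coords '' {x ∈ C | x.1.support ⊆ s}) := by
      intro s hs
      let e : ClosedSimplex P s → ι → ℝ := fun t => t.1.coords
      have he : Topology.IsClosedEmbedding e := by
        refine ⟨⟨⟨rfl⟩, ?_⟩, ?_⟩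
        · exact fun x y hxy => Subtype.ext (Realization.coords_injective P hxy)
        · have hr : range e = polyhedron (LowerSet.Iic s) := by
            let Ps : PreAbstractSimplicialComplex ι :=
              { faces := {t | t.Nonempty ∧ t ⊆ s}
                isRelLowerSet_faces := fun t ht =>
                  ⟨ht.1, fun t' ht' hne => ⟨hne, ht'.trans ht.2⟩⟩ }
            rw [← range_coords (P := Ps) (K := LowerSet.Iic s) fun t => Iff.rfl]
            ext t
            constructor
            · rintro ⟨⟨x, hx⟩, rfl⟩
              exact ⟨⟨x.1, x.2.1, x.2.2.1, (P.isRelLowerSet_faces x.2.2.2).1, hx⟩, rfl⟩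
            · rintro ⟨x, rfl⟩
              exact ⟨⟨⟨x.1, x.2.1, x.2.2.1,
                (P.isRelLowerSet_faces hs).2 x.2.2.2.2 x.2.2.2.1⟩, x.2.2.2.2⟩, rfl⟩
          rw [hr]
          exact isClosed_polyhedron _
      have hpre : IsClosed ((fun t : ClosedSimplex P s => t.1) ⁻¹' C) := by
        refine hC.preimage ?_
        exact continuous_iSup_rng (i := (⟨s, hs⟩ : P.faces)) continuous_coinduced_rng
      have := he.isClosedMap _ hpre
      convert this using 1
      ext t
      constructor
      · rintro ⟨x, ⟨hxC, hxs⟩, rfl⟩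
        exact ⟨⟨x, hxs⟩, hxC, rfl⟩
      · rintro ⟨⟨x, hxs⟩, hxC, rfl⟩
        exact ⟨x, ⟨hxC, hxs⟩, rfl⟩
    have hun : Realization.coords '' C =
        ⋃ s ∈ P.faces, Realization.coords '' {x ∈ C | x.1.support ⊆ s} := by
      ext t
      simp only [mem_iUnion]
      constructor
      · rintro ⟨x, hx, rfl⟩
        exact ⟨x.1.support, x.2.2.2, x, ⟨hx, subset_rfl⟩, rfl⟩
      · rintro ⟨s, -, x, hx, rfl⟩
        exact ⟨x, hx.1, rfl⟩
    rw [hun]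
    exact (Set.toFinite P.faces).isClosed_biUnion hcl

lemma subsingleton_homotopyGroup_of_isExtensor {X E : Type*} [TopologicalSpace X]
    [TopologicalSpace E] {e : X → E} (he : Topology.IsEmbedding e) {j : ℕ}
    (h : IsExtensor (j + 2) (range e)) (x : X) : Subsingleton (HomotopyGroup.Pi j X x) := by
  refine ⟨fun p q => ?_⟩
  induction p using Quotient.inductionOn with | _ p
  induction q using Quotient.inductionOn with | _ q
  refine Quotient.sound ?_
  let tl : (Fin (j + 1) → ℝ) → (Fin j → I) := fun y i => projIcc 0 1 zero_le_one (y i.succ)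
  have htl : Continuous tl := by
    refine continuous_pi fun i => continuous_projIcc.comp (continuous_apply _)
  let Z : Set (Fin (j + 1) → ℝ) := Icc 0 1
  let A : Set (Fin (j + 1) → ℝ) := Z ∩ ⋃ i, {y | y i = 0 ∨ y i = 1}
  have hA : IsClosed A := by
    refine isClosed_Icc.inter (isClosed_iUnion_of_finite fun i => ?_)
    exact (isClosed_eq (continuous_apply i) continuous_const).union
      (isClosed_eq (continuous_apply i) continuous_const)
  have hbd : ∀ y ∈ A, y 0 ≠ 0 → y 0 ≠ 1 → tl y ∈ Cube.boundary (Fin j) := by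
    rintro y ⟨-, hy⟩ h0 h1
    obtain ⟨i, hi⟩ := mem_iUnion.1 hy
    rcases Fin.eq_zero_or_eq_succ i with rfl | ⟨i, rfl⟩
    · exact (hi.elim h0 h1).elim
    · refine ⟨i, hi.imp (fun h => ?_) fun h => ?_⟩
      · simp only [tl, h]
        exact projIcc_left zero_le_one
      · simp only [tl, h]
        exact projIcc_right zero_le_one
  obtain ⟨f, hf, hf1, hf2⟩ := exists_continuousOn_union
    (S := A ∩ {y | y 0 ≤ 1 / 2}) (T := A ∩ {y | 1 / 2 ≤ y 0})
    (f := fun y => e (p (tl y))) (g := fun y => e (q (tl y)))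
    (hA.inter (isClosed_le (continuous_apply 0) continuous_const))
    (hA.inter (isClosed_le continuous_const (continuous_apply 0)))
    (he.continuous.comp (p.1.continuous.comp htl)).continuousOn
    (he.continuous.comp (q.1.continuous.comp htl)).continuousOn
    (by
      rintro y ⟨⟨hy, h1⟩, ⟨-, h2⟩⟩
      have h3 : y 0 = 1 / 2 := le_antisymm h1 h2
      have := hbd y hy (by rw [h3]; norm_num) (by rw [h3]; norm_num)
      simp only [GenLoop.boundary p _ this, GenLoop.boundary q _ this])
  have hAu : A ∩ {y | y 0 ≤ 1 / 2} ∪ A ∩ {y | 1 / 2 ≤ y 0} = A := by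
    rw [← inter_union_distrib_left, inter_eq_left]
    exact fun y _ => le_total (y 0) (1 / 2)
  rw [hAu] at hf
  obtain ⟨g, hg, hgX, hgf⟩ := h (j + 1) 0 Z A f (by omega) isClosed_Icc hA inter_subset_left
    (fun y _ r hr => absurd hr (Nat.not_lt_zero r)) hf
    (by
      intro y hy
      have hy' := hy
      rw [← hAu] at hy'
      rcases hy' with hy' | hy'
      · rw [hf1 hy']; exact mem_range_self _
      · rw [hf2 hy']; exact mem_range_self _)
  let c : I × (Fin j → I) → Fin (j + 1) → ℝ := fun w => Fin.cons (w.1 : ℝ) fun i => (w.2 i : ℝ)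
  have hc : Continuous c := by
    refine continuous_pi fun i => ?_
    rcases Fin.eq_zero_or_eq_succ i with rfl | ⟨i, rfl⟩
    · simp only [c, Fin.cons_zero]; fun_prop
    · simp only [c, Fin.cons_succ]; fun_prop
  have hcZ : ∀ w, c w ∈ Z := by
    intro w
    constructor
    · intro i
      rcases Fin.eq_zero_or_eq_succ i with rfl | ⟨i, rfl⟩
      · exact w.1.2.1
      · exact (w.2 i).2.1
    · intro i
      rcases Fin.eq_zero_or_eq_succ i with rfl | ⟨i, rfl⟩
      · exact w.1.2.2
      · exact (w.2 i).2.2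
  have htc : ∀ w, tl (c w) = w.2 := by
    intro w
    funext i
    simp only [tl, c, Fin.cons_succ]
    exact projIcc_val zero_le_one (w.2 i)
  choose F hF using fun w => hgX (hcZ w)
  have hFc : Continuous F := by
    rw [he.isInducing.continuous_iff]
    have : e ∘ F = g ∘ c := funext hF
    rw [this]
    exact hg.comp_continuous hc hcZ
  have hFA : ∀ w, c w ∈ A →
      ((w.1 : ℝ) ≤ 1 / 2 → F w = p w.2) ∧ (1 / 2 ≤ (w.1 : ℝ) → F w = q w.2) := by
    intro w hw
    constructor
    · intro h1
      apply he.injective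
      rw [hF, hgf hw, hf1 ⟨hw, h1⟩]
      simp only [htc]
    · intro h1
      apply he.injective
      rw [hF, hgf hw, hf2 ⟨hw, h1⟩]
      simp only [htc]
  have hcA : ∀ w, (w.1 = 0 ∨ w.1 = 1 ∨ w.2 ∈ Cube.boundary (Fin j)) → c w ∈ A := by
    intro w hw
    refine ⟨hcZ w, mem_iUnion.2 ?_⟩
    rcases hw with h | h | ⟨i, h⟩
    · exact ⟨0, Or.inl (by simp [c, h])⟩
    · exact ⟨0, Or.inr (by simp [c, h])⟩
    · exact ⟨i.succ, h.imp (fun h => by simp [c, h]) fun h => by simp [c, h]⟩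
  refine ⟨⟨⟨⟨F, hFc⟩, fun y => ?_, fun y => ?_⟩, fun t y hy => ?_⟩⟩
  · exact (hFA (0, y) (hcA _ (Or.inl rfl))).1 (by norm_num)
  · exact (hFA (1, y) (hcA _ (Or.inr (Or.inl rfl)))).2 (by norm_num)
  · have := hFA (t, y) (hcA _ (Or.inr (Or.inr hy)))
    change F (t, y) = p y
    rcases le_total (t : ℝ) (1 / 2) with h1 | h1
    · exact this.1 h1
    · rw [this.2 h1, GenLoop.boundary p y hy, GenLoop.boundary q y hy]

lemma isNConnected_of_conn {P : PreAbstractSimplicialComplex ι} {K : LowerSet (Finset ι)}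
    (hPK : SameFaces P K) {m : ℕ} (hK : Conn m K) {c : ℚ} (hc : ∀ n : ℕ, (n : ℚ) ≤ c + 2 → n ≤ m) :
    IsNConnected c (Realization P) := by
  have hr := range_coords hPK
  constructor
  · intro h
    have : Conn 1 K := hK.mono (hc 1 (by push_cast; linarith))
    obtain ⟨t, ht⟩ := IsExtensor.nonempty this
    rw [← hr] at ht
    exact ⟨ht.choose⟩
  · intro j hj x
    have : Conn (j + 2) K := hK.mono (hc (j + 2) (by push_cast; linarith))
    rw [Conn, ← hr] at this
    exact subsingleton_homotopyGroup_of_isExtensor (isClosedEmbedding_coords P).isEmbedding this x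

end Realization

end Complexes

namespace Linking

open Complexes

/-! ### Morphisms from the standard form -/

section Hom

variable {M : Type*} [AddCommGroup M] {k : ℕ} {b : Form M}

lemma stdForm_intCast (k : ℕ) (m n m' n' : ℤ) :
    stdForm k ((m : ZMod k), (n : ZMod k)) ((m' : ZMod k), (n' : ZMod k)) =
      (m * n' - n * m') • invK k := by
  rw [← divByK_intCast]
  simp [stdForm]

lemma exists_intCast_pair (w : W k) : ∃ m n : ℤ, w = ((m : ZMod k), (n : ZMod k)) := by
  obtain ⟨m, hm⟩ := ZMod.intCast_surjective w.1
  obtain ⟨n, hn⟩ := ZMod.intCast_surjective w.2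
  exact ⟨m, n, Prod.ext hm.symm hn.symm⟩

lemma nsmul_W (w : W k) : k • w = 0 := by
  ext <;> simp

namespace Hom

/-- The image of the first standard generator. -/
def rho (f : Hom (stdForm k) b) : M := f.toFun (1, 0)

/-- The image of the second standard generator. -/
def sigma (f : Hom (stdForm k) b) : M := f.toFun (0, 1)

lemma nsmul_rho (f : Hom (stdForm k) b) : k • f.rho = 0 := by
  rw [rho, ← map_nsmul, nsmul_W, map_zero]

lemma nsmul_sigma (f : Hom (stdForm k) b) : k • f.sigma = 0 := by
  rw [sigma, ← map_nsmul, nsmul_W, map_zero]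

lemma form_rho_sigma (f : Hom (stdForm k) b) : b f.rho f.sigma = invK k := by
  rw [rho, sigma, f.map_form]
  simpa using stdForm_intCast k 1 0 0 1

lemma rho_mem_range (f : Hom (stdForm k) b) : f.rho ∈ f.range := ⟨_, rfl⟩

lemma sigma_mem_range (f : Hom (stdForm k) b) : f.sigma ∈ f.range := ⟨_, rfl⟩

lemma exists_eq_of_mem_range (f : Hom (stdForm k) b) {x : M} (hx : x ∈ f.range) :
    ∃ m n : ℤ, x = m • f.rho + n • f.sigma := by
  obtain ⟨w, rfl⟩ := hx
  obtain ⟨m, n, rfl⟩ := exists_intCast_pair w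
  refine ⟨m, n, ?_⟩
  rw [rho, sigma, ← map_zsmul, ← map_zsmul, ← map_add]
  congr 1
  ext <;> simp

lemma range_le_iff (f : Hom (stdForm k) b) {N : AddSubgroup M} :
    f.range ≤ N ↔ f.rho ∈ N ∧ f.sigma ∈ N := by
  refine ⟨fun h => ⟨h f.rho_mem_range, h f.sigma_mem_range⟩, fun h x hx => ?_⟩
  obtain ⟨m, n, rfl⟩ := f.exists_eq_of_mem_range hx
  exact add_mem (zsmul_mem h.1 _) (zsmul_mem h.2 _)

lemma mem_orthogonal_range_iff (hb : b.IsStrictlySkew) (f : Hom (stdForm k) b) {x : M} :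
    x ∈ b.orthogonal f.range ↔ b f.rho x = 0 ∧ b f.sigma x = 0 := by
  constructor
  · intro h
    rw [hb.skew, hb.skew f.sigma, h _ f.rho_mem_range, h _ f.sigma_mem_range]
    simp
  · rintro ⟨h1, h2⟩ y hy
    obtain ⟨m, n, rfl⟩ := f.exists_eq_of_mem_range hy
    rw [hb.skew]
    simp [h1, h2]

lemma range_le_orthogonal_comm (hb : b.IsStrictlySkew) {N N' : AddSubgroup M}
    (h : N ≤ b.orthogonal N') : N' ≤ b.orthogonal N := by
  intro x hx y hy
  rw [hb.skew, h hy x hx, neg_zero]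

lemma not_range_le_orthogonal_self (hk : 2 ≤ k) (f : Hom (stdForm k) b) :
    ¬ f.range ≤ b.orthogonal f.range := by
  intro h
  have := h f.rho_mem_range _ f.sigma_mem_range
  rw [form_rho_sigma] at this
  exact invK_ne_zero hk this

lemma areOrthogonal_iff (hk : 0 < k) (hb : b.IsStrictlySkew) (f f' : Hom (stdForm k) b) :
    b.AreOrthogonal f.range f'.range ↔ f.range ≤ b.orthogonal f'.range := by
  refine ⟨fun h => h.1, fun h => ⟨h, range_le_orthogonal_comm hb h, ?_⟩⟩
  rw [eq_bot_iff]
  rintro x ⟨hx, hx'⟩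
  have h0 : ∀ y ∈ f.range, b y x = 0 := fun y hy => h hy x hx'
  obtain ⟨m, n, rfl⟩ := f.exists_eq_of_mem_range hx
  have h1 := h0 _ f.rho_mem_range
  have h2 := h0 _ f.sigma_mem_range
  have hsr : b f.sigma f.rho = -invK k := by rw [hb.skew, form_rho_sigma]
  simp only [map_add, map_zsmul, hb.self_eq_zero, form_rho_sigma, hsr, smul_zero, zero_add,
    add_zero, smul_neg, neg_eq_zero] at h1 h2
  rw [zsmul_invK_eq_zero_iff hk] at h1 h2
  obtain ⟨n, rfl⟩ := h1
  obtain ⟨m, rfl⟩ := h2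
  simp [mul_comm (k : ℤ), mul_smul, f.nsmul_rho, f.nsmul_sigma]

/-- The morphism determined by a hyperbolic pair. -/
lemma exists_of_pair (hb : b.IsStrictlySkew) {x y : M} (hx : k • x = 0) (hy : k • y = 0)
    (hxy : b x y = invK k) : ∃ f : Hom (stdForm k) b, f.rho = x ∧ f.sigma = y := by
  let φ : ZMod k →+ M := ZMod.lift k ⟨zmultiplesHom M x, by simpa using hx⟩
  let ψ : ZMod k →+ M := ZMod.lift k ⟨zmultiplesHom M y, by simpa using hy⟩
  have hφ : ∀ n : ℤ, φ n = n • x := fun n => by simp [φ]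
  have hψ : ∀ n : ℤ, ψ n = n • y := fun n => by simp [ψ]
  have hyx : b y x = -invK k := by rw [hb.skew, hxy]
  refine ⟨⟨φ.coprod ψ, fun w w' => ?_⟩, ?_, ?_⟩
  · obtain ⟨m, n, rfl⟩ := exists_intCast_pair w
    obtain ⟨m', n', rfl⟩ := exists_intCast_pair w'
    rw [stdForm_intCast]
    simp only [AddMonoidHom.coprod_apply, hφ, hψ, map_add, map_zsmul, AddMonoidHom.add_apply,
      AddMonoidHom.zsmul_apply, hb.self_eq_zero, hxy, hyx]
    module
  · simpa [rho] using hφ 1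
  · simpa [sigma] using hψ 1

end Hom

instance [NeZero k] [Finite M] : Finite (Hom (stdForm k) b) :=
  Finite.of_injective (fun f => (f.toFun : W k → M)) fun _ _ h =>
    Hom.ext (DFunLike.coe_injective h)

/-- The subgroup of elements of `N` orthogonal to all members of `σ`. -/
def perp (N : AddSubgroup M) (σ : Finset (Hom (stdForm k) b)) : AddSubgroup M :=
  N ⊓ ⨅ f ∈ σ, b.orthogonal f.range

lemma mem_perp {N : AddSubgroup M} {σ : Finset (Hom (stdForm k) b)} {x : M} :
    x ∈ perp N σ ↔ x ∈ N ∧ ∀ f ∈ σ, x ∈ b.orthogonal f.range := by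
  simp [perp, AddSubgroup.mem_inf, AddSubgroup.mem_iInf]

lemma HasRank.inf_orthogonal (hk : 0 < k) (hb : b.IsStrictlySkew) {N : AddSubgroup M} {g : ℕ}
    (h : HasRank k b N g) {f : Hom (stdForm k) b} (hf : f.range ≤ N) :
    HasRank k b (N ⊓ b.orthogonal f.range) (g - 1) := by
  have h1 := (h.inf_ker hk hb (b f.rho)).inf_ker_of_radical hk hb (x := f.rho) (y := f.sigma)
    ⟨hf f.rho_mem_range, hb.self_eq_zero _⟩ f.nsmul_rho (fun z hz => hz.2) f.form_rho_sigma
  have h2 : N ⊓ (b f.rho).ker ⊓ (b f.sigma).ker = N ⊓ b.orthogonal f.range := by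
    ext x
    simp only [AddSubgroup.mem_inf, f.mem_orthogonal_range_iff hb, AddMonoidHom.mem_ker, and_assoc]
  rwa [h2] at h1

lemma HasRank.perp (hk : 0 < k) (hb : b.IsStrictlySkew) {N : AddSubgroup M} {g : ℕ}
    (h : HasRank k b N g) {σ : Finset (Hom (stdForm k) b)} (hN : ∀ f ∈ σ, f.range ≤ N)
    (hσ : ∀ f ∈ σ, ∀ f' ∈ σ, f ≠ f' → f.range ≤ b.orthogonal f'.range) :
    HasRank k b (perp N σ) (g - σ.card) := by
  classical
  induction σ using Finset.induction_on with
  | empty => simpa [Linking.perp] using h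
  | insert f σ hf ih =>
    have ih := ih (fun f' hf' => hN f' (Finset.mem_insert_of_mem hf'))
      fun f₁ h₁ f₂ h₂ => hσ f₁ (Finset.mem_insert_of_mem h₁) f₂ (Finset.mem_insert_of_mem h₂)
    have hfp : f.range ≤ Linking.perp N σ := by
      intro x hx
      refine mem_perp.2 ⟨hN f (Finset.mem_insert_self f σ) hx, fun f' hf' => ?_⟩
      exact hσ f (Finset.mem_insert_self f σ) f' (Finset.mem_insert_of_mem hf')
        (fun h => hf (h ▸ hf')) hx
    have h1 := ih.inf_orthogonal hk hb hfp
    have h2 : Linking.perp N σ ⊓ b.orthogonal f.range = Linking.perp N (insert f σ) := by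
      ext x
      simp only [AddSubgroup.mem_inf, mem_perp, Finset.forall_mem_insert]
      tauto
    rw [h2] at h1
    rw [Finset.card_insert_of_notMem hf]
    exact h1.mono (by omega)

end Hom

/-! ### The complex of a subgroup -/

section Complex

variable {M : Type*} [AddCommGroup M] {k : ℕ} {b : Form M}

/-- The subcomplex of `linkingComplex k b` of simplices with images in `N`, as a lower set. -/
def complexWithin (k : ℕ) (b : Form M) (N : AddSubgroup M) :
    LowerSet (Finset (Hom (stdForm k) b)) where
  carrier := {s | (∀ f ∈ s, f.range ≤ N) ∧
    ∀ f ∈ s, ∀ f' ∈ s, f ≠ f' → f.range ≤ b.orthogonal f'.range}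
  lower' := fun _ _ h hs => ⟨fun f hf => hs.1 f (h hf),
    fun f hf f' hf' => hs.2 f (h hf) f' (h hf')⟩

lemma complexWithin_mono {N N' : AddSubgroup M} (h : N ≤ N') :
    complexWithin k b N ≤ complexWithin k b N' :=
  fun _ hs => ⟨fun f hf => (hs.1 f hf).trans h, hs.2⟩

lemma empty_mem_complexWithin (N : AddSubgroup M) : ∅ ∈ complexWithin k b N :=
  ⟨by simp, by simp⟩

lemma union_mem_complexWithin [DecidableEq (Hom (stdForm k) b)] (hb : b.IsStrictlySkew)
    {N : AddSubgroup M} {σ τ : Finset (Hom (stdForm k) b)} (hτ : τ ∈ complexWithin k b N)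
    (hσ : σ ∈ complexWithin k b N) (h : ∀ f ∈ τ, ∀ f' ∈ σ, f.range ≤ b.orthogonal f'.range) :
    τ ∪ σ ∈ complexWithin k b N := by
  refine ⟨fun f hf => (Finset.mem_union.1 hf).elim (hτ.1 f) (hσ.1 f), fun f hf f' hf' hne => ?_⟩
  rcases Finset.mem_union.1 hf with hf | hf <;> rcases Finset.mem_union.1 hf' with hf' | hf'
  · exact hτ.2 f hf f' hf' hne
  · exact h f hf f' hf'
  · exact Hom.range_le_orthogonal_comm hb (h f' hf' f hf)
  · exact hσ.2 f hf f' hf' hne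

lemma linkWithin_complexWithin [DecidableEq (Hom (stdForm k) b)] (hb : b.IsStrictlySkew)
    {N N' : AddSubgroup M} (hN : N' ≤ N) {σ : Finset (Hom (stdForm k) b)}
    (hσ : σ ∈ complexWithin k b N) (hσV : ∀ f ∈ σ, ¬ f.range ≤ N') :
    linkWithin (complexWithin k b N) {f | f.range ≤ N'} σ = complexWithin k b (perp N' σ) := by
  ext τ
  constructor
  · rintro ⟨h1, h2⟩
    refine ⟨fun f hf x hx => mem_perp.2 ⟨h1 f hf hx, fun f' hf' => ?_⟩, fun f hf f' hf' =>
      h2.2 f (Finset.mem_union_left _ hf) f' (Finset.mem_union_left _ hf')⟩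
    refine h2.2 f (Finset.mem_union_left _ hf) f' (Finset.mem_union_right _ hf') ?_ hx
    rintro rfl
    exact hσV f hf' (h1 f hf)
  · rintro ⟨h1, h2⟩
    have h3 : ∀ f ∈ τ, ∀ f' ∈ σ, f.range ≤ b.orthogonal f'.range := fun f hf f' hf' x hx =>
      (mem_perp.1 (h1 f hf hx)).2 f' hf'
    have h4 : ∀ f ∈ τ, f.range ≤ N' := fun f hf x hx => (mem_perp.1 (h1 f hf hx)).1
    exact ⟨h4, union_mem_complexWithin hb ⟨fun f hf => (h4 f hf).trans hN, h2⟩ hσ h3⟩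

theorem conn_complexWithin [Fintype (Hom (stdForm k) b)] (hk : 2 ≤ k) (hb : b.IsStrictlySkew)
    {g : ℕ} {N : AddSubgroup M} (h : HasRank k b N g) : Conn (g / 2) (complexWithin k b N) := by
  classical
  induction g using Nat.strong_induction_on generalizing N with
  | _ g ih =>
  have hk0 : 0 < k := by omega
  by_cases hg : g < 2
  · rw [Nat.div_eq_of_lt hg]
    exact conn_zero _
  obtain ⟨v, hvN⟩ : ∃ v : Hom (stdForm k) b, v.range ≤ N := by
    obtain ⟨ρ, σ, h, hN⟩ := h
    have hi : 0 < g := by omega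
    obtain ⟨v, hv1, hv2⟩ := Hom.exists_of_pair hb (h.nsmul_left ⟨0, hi⟩) (h.nsmul_right ⟨0, hi⟩)
      (by rw [h.left_right, if_pos rfl])
    exact ⟨v, v.range_le_iff.2 (by rw [hv1, hv2]; exact hN _)⟩
  set N₂ := N ⊓ (b v.rho).ker with hN₂
  set N₁ := N₂ ⊓ (b v.sigma).ker with hN₁
  have hrank₂ : HasRank k b N₂ (g - 1) := h.inf_ker hk0 hb _
  have hN₁v : ∀ x, x ∈ N₁ ↔ x ∈ N ∧ x ∈ b.orthogonal v.range := by
    intro x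
    simp only [hN₁, hN₂, AddSubgroup.mem_inf, v.mem_orthogonal_range_iff hb, AddMonoidHom.mem_ker,
      and_assoc]
  have hle₁₂ : N₁ ≤ N₂ := inf_le_left
  have hle₂ : N₂ ≤ N := inf_le_left
  have hvN₂ : ¬ v.range ≤ N₂ := by
    intro hv
    have : b v.rho v.sigma = 0 := (hv v.sigma_mem_range).2
    rw [v.form_rho_sigma] at this
    exact invK_ne_zero hk this
  set T₀ := cone v (complexWithin k b N₁) with hT₀
  have hT₀mem : ∀ ξ, ξ ∈ T₀ ↔ ξ.erase v ∈ complexWithin k b N₁ := fun ξ => Iff.rfl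
  have hempty₀ : ∅ ∈ T₀ := by
    rw [hT₀mem, Finset.erase_empty]
    exact empty_mem_complexWithin N₁
  have hTle : T₀ ≤ complexWithin k b N := by
    intro ξ hξ
    have hx : ∀ f ∈ ξ, f ≠ v → f.range ≤ N₁ := fun f hf hne =>
      hξ.1 f (Finset.mem_erase.2 ⟨hne, hf⟩)
    have hxv : ∀ f ∈ ξ, f ≠ v → f.range ≤ b.orthogonal v.range := fun f hf hne x hx' =>
      ((hN₁v x).1 (hx f hf hne hx')).2
    refine ⟨fun f hf => ?_, fun f hf f' hf' hne => ?_⟩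
    · rcases eq_or_ne f v with rfl | hfv
      · exact hvN
      · exact (hx f hf hfv).trans (hle₁₂.trans hle₂)
    · rcases eq_or_ne f' v with rfl | hf'v
      · exact hxv f hf hne
      · rcases eq_or_ne f v with rfl | hfv
        · exact Hom.range_le_orthogonal_comm hb (hxv f' hf' hf'v)
        · exact hξ.2 f (Finset.mem_erase.2 ⟨hfv, hf⟩) f' (Finset.mem_erase.2 ⟨hf'v, hf'⟩) hne
  set T₁ := complexWithin k b N₂ ⊔ T₀ with hT₁
  have hcard : ∀ {T : LowerSet (Finset (Hom (stdForm k) b))} {σ}, ∅ ∈ T → σ ∉ T → 0 < σ.card := by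
    intro T σ h0 hσ
    rw [Finset.card_pos, Finset.nonempty_iff_ne_empty]
    rintro rfl
    exact hσ h0
  have hconn₁ : Conn (g / 2) T₁ := by
    refine conn_of_linkWithin {f | f.range ≤ N₁} T₁ T₀ le_sup_right hempty₀ ?_
      (conn_cone _ v _ (empty_mem_complexWithin N₁)) ?_
    · rintro ξ (hξ | hξ) σ hσ hξσ
      · refine ⟨fun f hf => ?_, fun f hf f' hf' =>
          hξ.2 f (Finset.mem_of_mem_erase hf) f' (Finset.mem_of_mem_erase hf')⟩
        by_contra hfV
        have hfσ := hξσ f (Finset.mem_of_mem_erase hf) hfV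
        exact hfV (hσ.1 f (Finset.mem_erase.2 ⟨Finset.ne_of_mem_erase hf, hfσ⟩))
      · exact hξ
    · intro σ hσ hσT hσV
      have hσ₂ : σ ∈ complexWithin k b N₂ := hσ.resolve_right hσT
      have hlink : linkWithin T₁ {f | f.range ≤ N₁} σ =
          linkWithin (complexWithin k b N₂) {f | f.range ≤ N₁} σ := by
        ext τ
        refine and_congr_right fun _ => ⟨fun h => h.resolve_right fun h => ?_, Or.inl⟩
        exact hσT (T₀.lower Finset.subset_union_right h)
      have hrho : v.rho ∈ perp N₂ σ := by
        refine mem_perp.2 ⟨⟨hvN v.rho_mem_range, hb.self_eq_zero _⟩, fun f hf y hy => ?_⟩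
        exact (hσ₂.1 f hf hy).2
      have hr := (hrank₂.perp hk0 hb hσ₂.1 hσ₂.2).inf_ker_of_radical hk0 hb hrho v.nsmul_rho
        (fun z hz => (mem_perp.1 hz).1.2) v.form_rho_sigma
      have hperp : perp N₂ σ ⊓ (b v.sigma).ker = perp N₁ σ := by
        ext x
        simp only [hN₁, AddSubgroup.mem_inf, mem_perp]
        tauto
      rw [hlink, linkWithin_complexWithin hb hle₁₂ hσ₂ hσV, ← hperp]
      have hc := hcard hempty₀ hσT
      exact (ih _ (by omega) hr).mono (by omega)
  refine conn_of_linkWithin {f | f.range ≤ N₂} (complexWithin k b N) T₁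
    (sup_le (complexWithin_mono hle₂) hTle) (Or.inr hempty₀) ?_ hconn₁ ?_
  · intro ξ hξ σ hσ hξσ
    have hV : ∀ f ∈ ξ, f ≠ v → f.range ≤ N₂ := by
      intro f hf hne
      by_contra hfV
      have hfσ := hξσ f hf hfV
      rcases hσ with hσ | hσ
      · exact hfV (hσ.1 f hfσ)
      · exact hfV ((hσ.1 f (Finset.mem_erase.2 ⟨hne, hfσ⟩)).trans hle₁₂)
    by_cases hvξ : v ∈ ξ
    · refine Or.inr ⟨fun f hf x hx => (hN₁v x).2 ?_, fun f hf f' hf' =>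
          hξ.2 f (Finset.mem_of_mem_erase hf) f' (Finset.mem_of_mem_erase hf')⟩
      have hf' := Finset.mem_of_mem_erase hf
      exact ⟨hξ.1 f hf' hx, hξ.2 f hf' v hvξ (Finset.ne_of_mem_erase hf) hx⟩
    · exact Or.inl ⟨fun f hf => hV f hf fun h => hvξ (h ▸ hf), hξ.2⟩
  · intro σ hσ hσT hσV
    have hr := (h.perp hk0 hb hσ.1 hσ.2).inf_ker hk0 hb (b v.rho)
    have hperp : perp N σ ⊓ (b v.rho).ker = perp N₂ σ := by
      ext x
      simp only [hN₂, AddSubgroup.mem_inf, mem_perp]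
      tauto
    rw [linkWithin_complexWithin hb hle₂ hσ hσV, ← hperp]
    have hc := hcard (T := T₁) (Or.inr hempty₀) hσT
    exact (ih _ (by omega) hr).mono (by omega)

end Complex

/-! ### Rank and stable rank -/

section Rank

variable {M : Type*} [AddCommGroup M] {k : ℕ} {b : Form M}

lemma isStrictlySkew_stdForm (k : ℕ) : (stdForm k).IsStrictlySkew where
  skew x y := by
    change divByK k _ = -divByK k _
    rw [← map_neg]
    congr 1
    ring
  self_eq_zero x := by
    change divByK k _ = 0
    rw [mul_comm, sub_self, map_zero]

lemma power_apply (b : Form M) (g : ℕ) (x y : Fin g → M) :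
    b.power g x y = ∑ i, b (x i) (y i) := by
  simp [Form.power, AddMonoidHom.finsetSum_apply]

lemma directSum_apply {N : Type*} [AddCommGroup N] (b : Form M) (c : Form N) (x y : M × N) :
    b.directSum c x y = b x.1 y.1 + c x.2 y.2 := by
  simp [Form.directSum]

lemma Form.IsStrictlySkew.power (hb : b.IsStrictlySkew) (g : ℕ) :
    (b.power g).IsStrictlySkew where
  skew x y := by
    rw [power_apply, power_apply, ← Finset.sum_neg_distrib]
    exact Finset.sum_congr rfl fun i _ => hb.skew _ _
  self_eq_zero x := by
    rw [power_apply]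
    exact Finset.sum_eq_zero fun i _ => hb.self_eq_zero _

lemma Form.IsStrictlySkew.directSum {N : Type*} [AddCommGroup N] {c : Form N}
    (hb : b.IsStrictlySkew) (hc : c.IsStrictlySkew) : (b.directSum c).IsStrictlySkew where
  skew x y := by
    rw [directSum_apply, directSum_apply, hb.skew, hc.skew, neg_add]
  self_eq_zero x := by
    rw [directSum_apply, hb.self_eq_zero, hc.self_eq_zero, add_zero]

lemma power_single (b : Form M) (g : ℕ) (i j : Fin g) (x y : M) :
    b.power g (Pi.single i x) (Pi.single j y) = if i = j then b x y else 0 := by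
  rw [power_apply, Finset.sum_eq_single i]
  · rcases eq_or_ne i j with rfl | h
    · simp
    · simp [h]
  · intro l _ hl
    simp [Pi.single_eq_of_ne hl]
  · simp

lemma hasRank_top_of_hom {g : ℕ} (f : Hom ((stdForm k).power g) b) : HasRank k b ⊤ g := by
  have hform : ∀ i j x y, b (f.toFun (Pi.single i x)) (f.toFun (Pi.single j y)) =
      if i = j then stdForm k x y else 0 := fun i j x y => by rw [f.map_form, power_single]
  have hsmul : ∀ x, k • f.toFun x = 0 := by
    intro x
    rw [← map_nsmul]
    have : k • x = 0 := funext fun i => nsmul_W (x i)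
    rw [this, map_zero]
  refine ⟨fun i => f.toFun (Pi.single i (1, 0)), fun i => f.toFun (Pi.single i (0, 1)),
    ⟨fun i => hsmul _, fun i => hsmul _, fun i j => ?_, fun i j => ?_, fun i j => ?_⟩,
    fun i => ⟨trivial, trivial⟩⟩
  · rw [hform, (isStrictlySkew_stdForm k).self_eq_zero, ite_self]
  · rw [hform, (isStrictlySkew_stdForm k).self_eq_zero, ite_self]
  · rw [hform]
    congr 1
    simpa using stdForm_intCast k 1 0 0 1

/-- Hyperbolic summands can be cancelled. -/
lemma hasRank_of_directSum_power (hk : 0 < k) (hb : b.IsStrictlySkew) {g h : ℕ}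
    (hr : HasRank k (b.directSum ((stdForm k).power h)) ⊤ (g + h)) : HasRank k b ⊤ g := by
  classical
  set c := b.directSum ((stdForm k).power h)
  have hW := isStrictlySkew_stdForm k
  have hc : c.IsStrictlySkew := hb.directSum (hW.power h)
  let v : Fin h → Hom (stdForm k) c := fun i =>
    ⟨(AddMonoidHom.inr M (Fin h → W k)).comp (AddMonoidHom.single (fun _ => W k) i), fun x y => by
      simp [c, directSum_apply, power_single]⟩
  have hv : ∀ i w, (v i).toFun w = (0, Pi.single i w) := fun i w => rfl
  have h1 := hr.perp hk hc (σ := Finset.univ.image v) (fun _ _ => le_top) (by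
    intro f hf f' hf' hne
    obtain ⟨i, -, rfl⟩ := Finset.mem_image.1 hf
    obtain ⟨j, -, rfl⟩ := Finset.mem_image.1 hf'
    rintro _ ⟨x, rfl⟩ _ ⟨y, rfl⟩
    have hij : i ≠ j := fun h => hne (h ▸ rfl)
    rw [hv, hv]
    simp [c, directSum_apply, power_single, hij])
  have hcard : (Finset.univ.image v).card ≤ h := by
    simpa using Finset.card_image_le (s := Finset.univ) (f := v)
  obtain ⟨ρ, σ, hs, hN⟩ := h1.mono (g' := g) (by omega)
  have hzero : ∀ x ∈ perp ⊤ (Finset.univ.image v), x.2 = 0 := by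
    intro x hx
    funext i
    have hx' : ∀ w, stdForm k (x.2 i) w = 0 := by
      intro w
      have := (mem_perp.1 hx).2 (v i) (Finset.mem_image_of_mem v (Finset.mem_univ i)) _ ⟨w, rfl⟩
      rw [hv, directSum_apply, power_apply, Finset.sum_eq_single i] at this
      · simpa using this
      · intro l _ hl
        simp [Pi.single_eq_of_ne hl]
      · simp
    obtain ⟨m, n, hmn⟩ := exists_intCast_pair (x.2 i)
    have e1 := hx' (((0 : ℤ) : ZMod k), ((1 : ℤ) : ZMod k))
    have e2 := hx' (((1 : ℤ) : ZMod k), ((0 : ℤ) : ZMod k))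
    rw [hmn, stdForm_intCast, zsmul_invK_eq_zero_iff hk] at e1 e2
    have e1' : (k : ℤ) ∣ m := by simpa using e1
    have e2' : (k : ℤ) ∣ n := by simpa using e2
    rw [hmn, (ZMod.intCast_zmod_eq_zero_iff_dvd m k).2 e1',
      (ZMod.intCast_zmod_eq_zero_iff_dvd n k).2 e2']
    rfl
  have hform : ∀ x y, y ∈ perp ⊤ (Finset.univ.image v) → c x y = b x.1 y.1 := by
    intro x y hy
    rw [directSum_apply, hzero y hy, map_zero, add_zero]
  refine ⟨fun i => (ρ i).1, fun i => (σ i).1, ⟨fun i => ?_, fun i => ?_, fun i j => ?_,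
    fun i j => ?_, fun i j => ?_⟩, fun i => ⟨trivial, trivial⟩⟩
  · exact congrArg Prod.fst (hs.nsmul_left i)
  · exact congrArg Prod.fst (hs.nsmul_right i)
  · rw [← hform _ _ (hN j).1, hs.left_left]
  · rw [← hform _ _ (hN j).2, hs.right_right]
  · rw [← hform _ _ (hN j).2, hs.left_right]

lemma hasRank_of_le_stableRank (hk : 0 < k) (hb : b.IsStrictlySkew) {g : ℕ}
    (hg : (g : ℤ) ≤ stableRank k b) : HasRank k b ⊤ g := by
  rcases Nat.eq_zero_or_pos g with rfl | hpos
  · exact ⟨Fin.elim0, Fin.elim0, ⟨fun i => i.elim0, fun i => i.elim0, fun i => i.elim0,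
      fun i => i.elim0, fun i => i.elim0⟩, fun i => i.elim0⟩
  have hbdd : BddAbove (Set.range fun h : ℕ =>
      (kRank k (b.directSum ((stdForm k).power h)) : ℤ) - h) := by
    by_contra hn
    rw [stableRank, Int.csSup_of_not_bddAbove hn] at hg
    omega
  obtain ⟨h, hh⟩ := Int.csSup_mem (Set.range_nonempty _) hbdd
  change _ = stableRank k b at hh
  have hle : g + h ≤ kRank k (b.directSum ((stdForm k).power h)) := by
    simp only at hh
    omega
  have hmem : kRank k (b.directSum ((stdForm k).power h)) ∈
      {n : ℕ | Nonempty (Hom ((stdForm k).power n) (b.directSum ((stdForm k).power h)))} := by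
    refine Nat.sSup_mem ⟨0, ⟨0, fun x y => ?_⟩⟩ ?_
    · rw [power_apply]
      simp
    · by_contra hn
      have : kRank k (b.directSum ((stdForm k).power h)) = 0 := by
        rw [kRank]
        exact Nat.sSup_of_not_bddAbove hn
      omega
  obtain ⟨f⟩ := hmem
  exact hasRank_of_directSum_power hk hb ((hasRank_top_of_hom f).mono hle)

end Rank

/-! ### Connectivity of the linking complex -/

section Main

variable {M : Type*} [AddCommGroup M] {k : ℕ} {b : Form M}

lemma sameFaces_linkingComplex (hk : 0 < k) (hb : b.IsStrictlySkew) :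
    SameFaces (linkingComplex k b).toPreAbstractSimplicialComplex (complexWithin k b ⊤) := by
  intro s
  refine and_congr_right fun _ => ⟨fun h => ⟨fun _ _ => le_top, ?_⟩, fun h => ?_⟩
  · exact fun f hf f' hf' hne => (h f hf f' hf' hne).1
  · exact fun f hf f' hf' hne => (Hom.areOrthogonal_iff hk hb f f').2 (h.2 f hf f' hf' hne)

lemma sameFaces_link (hk : 2 ≤ k) (hb : b.IsStrictlySkew) {σ : Finset (Hom (stdForm k) b)}
    (hσ : σ ∈ (linkingComplex k b).faces) :
    SameFaces (link (linkingComplex k b).toPreAbstractSimplicialComplex σ)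
      (complexWithin k b (perp ⊤ σ)) := by
  classical
  have hk0 : 0 < k := by omega
  have hsame := sameFaces_linkingComplex hk0 hb
  have hσ' := ((hsame σ).1 hσ).2
  intro ζ
  constructor
  · rintro ⟨hζ, hd, ξ, hξ, hσξ, hζξ⟩
    have hξ' := ((hsame ξ).1 hξ).2
    refine ⟨hζ.1, fun f hf x hx => mem_perp.2 ⟨trivial, fun f' hf' => ?_⟩,
      ((hsame ζ).1 hζ).2.2⟩
    refine hξ'.2 f (hζξ hf) f' (hσξ hf') ?_ hx
    rintro rfl
    exact Finset.disjoint_left.1 hd hf hf'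
  · rintro ⟨hne, h1, h2⟩
    have h3 : ∀ f ∈ ζ, ∀ f' ∈ σ, f.range ≤ b.orthogonal f'.range := fun f hf f' hf' x hx =>
      (mem_perp.1 (h1 f hf hx)).2 f' hf'
    have hζ : ζ ∈ complexWithin k b ⊤ := ⟨fun _ _ => le_top, h2⟩
    refine ⟨(hsame ζ).2 ⟨hne, hζ⟩, ?_, ζ ∪ σ, (hsame _).2 ⟨hne.mono Finset.subset_union_left,
      union_mem_complexWithin hb hζ hσ' h3⟩, Finset.subset_union_right, Finset.subset_union_left⟩
    exact Finset.disjoint_left.2 fun f hf hf' => f.not_range_le_orthogonal_self hk (h3 f hf f hf')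

end Main

end Linking

end

theorem mainTheorem4 (k : ℕ) (hk : 2 ≤ k) (g : ℕ)
    {M : Type*} [AddCommGroup M] [Finite M]
    (b : Linking.Form M) (hb : b.IsStrictlySkew)
    (hg : (g : ℤ) ≤ Linking.stableRank k b) :
    Complexes.IsNConnected (((g : ℚ) - 4) / 2)
        (Complexes.Realization (Linking.linkingComplex k b).toPreAbstractSimplicialComplex) ∧
      Complexes.LocallyCMGE (Linking.linkingComplex k b).toPreAbstractSimplicialComplex
        (((g : ℚ) - 1) / 2) := by
  have hk0 : 0 < k := by omega
  have : NeZero k := ⟨hk0.ne'⟩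
  have : Fintype (Linking.Hom (Linking.stdForm k) b) := Fintype.ofFinite _
  have hr := Linking.hasRank_of_le_stableRank hk0 hb hg
  have hsame := Linking.sameFaces_linkingComplex hk0 hb
  refine ⟨Complexes.isNConnected_of_conn hsame (Linking.conn_complexWithin hk hb hr) ?_, ?_⟩
  · intro n hn
    have h2 : (n : ℚ) * 2 ≤ g := by linarith
    have h2' : n * 2 ≤ g := by exact_mod_cast h2
    omega
  · intro p σ hσ hcard
    have hσ' := ((hsame σ).1 hσ).2
    refine Complexes.isNConnected_of_conn (Linking.sameFaces_link hk hb hσ)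
      (Linking.conn_complexWithin hk hb (hr.perp hk0 hb hσ'.1 hσ'.2)) ?_
    intro n hn
    have h2 : ((n * 2 + p * 2 + 1 : ℕ) : ℚ) ≤ g := by push_cast; linarith
    have h2' : n * 2 + p * 2 + 1 ≤ g := by exact_mod_cast h2
    omega
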